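/- Let $\Omega\subset\mathbb R^2$ be a bounded open set with smooth boundary, and let $G_\Omega$ be its Green's function with zero Dirichlet boundary conditions, $G_\Omega(x,y)=\frac1{2\pi}\log|x-y|^{-1}+g_\Omega(x,y)$, where for each $y\in\Omega$ the function $x\mapsto g_\Omega(x,y)$ is harmonic in $\Omega$, continuous on $\overline\Omega$ and equal to $-\frac1{2\pi}\log|x-y|^{-1}$ for $x\in\partial\Omega$, and $g_\Omega(x,y)=g_\Omega(y,x)$ for $x,y\in\Omega$. For $\alpha_1,\dots,\alpha_n\in\mathbb R$ write $\|\alpha\|=\max_{1\le i\le n}|\alpha_i|$, and for $A\subset\mathbb R^2$ and a function $f$ on $A$ write $$\|f\|_{\mathrm{Lip}(A)}=\sup_{x\in A}|f(x)|+\sup_{x,y\in A,\ x\ne y}\frac{|f(x)-f(y)|}{|x-y|}.$$ For $n\ge 2$, $\alpha_1,\dots,\alpha_n\in(-\sqrt{4\pi},\sqrt{4\pi})$ and $f_2,\dots,f_n\in C_c^\infty(\Omega)$ (possibly complex valued), let $$G_n(x_1)=\int_{\Omega^{n-1}}d^2x_2\cdots d^2x_n\ \prod_{j=2}^n f_j(x_j)\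 \exp\Big(-\sum_{1\le k<l\le n}\alpha_k\alpha_l\,G_\Omega(x_k,x_l)\Big),\qquad x_1\in\Omega.$$ Then this integral converges absolutely for every $x_1\in\Omega$; for each compact $K\subset\Omega$ the function $G_n$ is Lipschitz continuous on $K$; and there is a constant $C>0$ depending only on $K$, $\Omega$, $\|\alpha\|$, $\bigcup_{i=2}^n\mathrm{supp}(f_i)$ and $\max_{2\le i\le n}\|f_i\|_{\mathrm{Lip}(\Omega)}$ (in particular, not otherwise on $n$, the $\alpha_i$ or the $f_i$) such that $$\|G_n\|_{\mathrm{Lip}(K)}\le C^n\, n^{\frac{\|\alpha\|^2}{8\pi}n}.$$ -/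

import Mathlib

open MeasureTheory Topology InnerProductSpace
open scoped ContDiff

/-! Throughout, the plane is `ℂ`, with its Euclidean norm and Lebesgue measure. -/

/-- `Ω` is a bounded open subset of the plane with smooth boundary: near each boundary point it is
the sublevel set of a smooth function whose differential does not vanish at that point. -/
structure IsSmoothBoundedOpen (Ω : Set ℂ) : Prop where
  isOpen : IsOpen Ω
  isBounded : Bornology.IsBounded Ω
  smooth_boundary : ∀ p ∈ frontier Ω, ∃ U ∈ 𝓝 p, ∃ ρ : ℂ → ℝ,
    ContDiff ℝ ∞ ρ ∧ fderiv ℝ ρ p ≠ 0 ∧ ∀ x ∈ U, x ∈ Ω ↔ ρ x < 0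

/-- `g` is the regular part `g_Ω` of the Dirichlet Green's function of `Ω`: for every `y ∈ Ω` the
function `x ↦ g x y` is continuous on the closure of `Ω`, harmonic in `Ω`, and equal to
`-(1/2π) log |x - y|⁻¹` on `∂Ω`; and `g` is symmetric on `Ω × Ω`. -/
structure IsGreenRegularPart (Ω : Set ℂ) (g : ℂ → ℂ → ℝ) : Prop where
  continuousOn : ∀ y ∈ Ω, ContinuousOn (fun x => g x y) (closure Ω)
  harmonic : ∀ y ∈ Ω, HarmonicOnNhd (fun x => g x y) Ω
  boundary : ∀ y ∈ Ω, ∀ x ∈ frontier Ω,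
    g x y = -(1 / (2 * Real.pi) * Real.log ‖x - y‖⁻¹)
  symm : ∀ x ∈ Ω, ∀ y ∈ Ω, g x y = g y x

/-- Maximum principle: a harmonic function on a bounded open set that is continuous up to the
boundary and vanishes there is nonpositive. -/
theorem harmonic_nonpos_of_frontier {Ω : Set ℂ} (ho : IsOpen Ω) (hb : Bornology.IsBounded Ω)
    {u : ℂ → ℝ} (hc : ContinuousOn u (closure Ω)) (hh : HarmonicOnNhd u Ω)
    (h0 : ∀ x ∈ frontier Ω, u x = 0) : ∀ x ∈ closure Ω, u x ≤ 0 := by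
  intro x hx
  by_contra! hpos
  have hcomp : IsCompact (closure Ω) := hb.isCompact_closure
  obtain ⟨p, hp, hpmax⟩ := hcomp.exists_isMaxOn ⟨x, hx⟩ hc
  set M := u p with hM
  have hMpos : 0 < M := lt_of_lt_of_le hpos (hpmax hx)
  have hSc : IsCompact (closure Ω ∩ u ⁻¹' {M}) :=
    hcomp.of_isClosed_subset (hc.preimage_isClosed_of_isClosed isClosed_closure isClosed_singleton)
      Set.inter_subset_left
  obtain ⟨q, ⟨hq, hqM⟩, hqmax⟩ :=
    hSc.exists_isMaxOn ⟨p, hp, rfl⟩ Complex.continuous_re.continuousOn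
  have hqM' : u q = M := hqM
  have hqΩ : q ∈ Ω := by
    by_contra hn
    have : q ∈ frontier Ω := by
      rw [ho.frontier_eq]; exact ⟨hq, hn⟩
    have := h0 q this
    linarith
  obtain ⟨r, hr, hrΩ⟩ := Metric.isOpen_iff.1 ho q hqΩ
  obtain ⟨F, hF, hFu⟩ := (hh.mono hrΩ).exists_analyticOnNhd_ball_re_eq
  have hev : ∀ᶠ z in 𝓝 q, z ∈ Metric.ball q r := Metric.ball_mem_nhds q hr
  have hdiff : ∀ᶠ z in 𝓝 q, DifferentiableAt ℂ (fun z => Complex.exp (F z)) z := by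
    filter_upwards [hev] with z hz
    exact (hF z hz).differentiableAt.cexp
  have hnorm : ∀ z ∈ Metric.ball q r, ‖Complex.exp (F z)‖ = Real.exp (u z) := by
    intro z hz
    rw [Complex.norm_exp]
    congr 1
    exact hFu hz
  have hloc : IsLocalMax (norm ∘ fun z => Complex.exp (F z)) q := by
    filter_upwards [hev] with z hz
    simp only [Function.comp]
    rw [hnorm z hz, hnorm q (Metric.mem_ball_self hr), Real.exp_le_exp, hqM']
    exact hpmax (subset_closure (hrΩ hz))
  have hconst := Complex.eventually_eq_of_isLocalMax_norm hdiff hloc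
  have hconst' : ∀ᶠ z in 𝓝 q, z ∈ Metric.ball q r ∧ u z = M := by
    filter_upwards [hev, hconst] with z hz hz'
    refine ⟨hz, ?_⟩
    have h1 := hnorm z hz
    rw [hz', hnorm q (Metric.mem_ball_self hr), hqM'] at h1
    exact (Real.exp_injective h1).symm
  obtain ⟨s, hs, hsub⟩ := Metric.eventually_nhds_iff_ball.1 hconst'
  have hmem : q + ((s / 2 : ℝ) : ℂ) ∈ Metric.ball q s := by
    rw [Metric.mem_ball, dist_eq_norm, add_sub_cancel_left, Complex.norm_real,
      Real.norm_of_nonneg (by positivity)]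
    linarith
  obtain ⟨hz1, hz2⟩ := hsub _ hmem
  have hle : (q + ((s / 2 : ℝ) : ℂ)).re ≤ q.re :=
    hqmax (show q + ((s / 2 : ℝ) : ℂ) ∈ closure Ω ∩ u ⁻¹' {M} from
      ⟨subset_closure (hrΩ hz1), hz2⟩)
  rw [Complex.add_re, Complex.ofReal_re] at hle
  linarith

/-- The regular part of the Green's function is uniquely determined. -/
theorem IsGreenRegularPart.unique {Ω : Set ℂ} (ho : IsOpen Ω) (hb : Bornology.IsBounded Ω)
    {g h : ℂ → ℂ → ℝ} (hg : IsGreenRegularPart Ω g) (hh : IsGreenRegularPart Ω h) :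
    ∀ x ∈ closure Ω, ∀ y ∈ Ω, g x y = h x y := by
  have key : ∀ {g h : ℂ → ℂ → ℝ}, IsGreenRegularPart Ω g → IsGreenRegularPart Ω h →
      ∀ x ∈ closure Ω, ∀ y ∈ Ω, g x y ≤ h x y := by
    intro g h hg hh x hx y hy
    have := harmonic_nonpos_of_frontier ho hb
      (u := (fun x => g x y) - (fun x => h x y))
      ((hg.continuousOn y hy).sub (hh.continuousOn y hy))
      ((hg.harmonic y hy).sub (hh.harmonic y hy))
      (fun z hz => by simp [hg.boundary y hy z hz, hh.boundary y hy z hz]) x hx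
    simpa using this
  exact fun x hx y hy => le_antisymm (key hg hh x hx y hy) (key hh hg x hx y hy)

open Classical in
/-- The Green's function `G_Ω(x, y) = (1/2π) log |x - y|⁻¹ + g_Ω(x, y)` of `Ω` with zero Dirichlet
boundary conditions, for `x, y ∈ Ω`. The regular part `g_Ω` is unique, and it exists for a bounded
open set with smooth boundary; for a set without Green's function the value is `0`. -/
noncomputable def greenFunction (Ω : Set ℂ) (x y : ℂ) : ℝ :=
  if h : ∃ g, IsGreenRegularPart Ω g then
    1 / (2 * Real.pi) * Real.log ‖x - y‖⁻¹ + h.choose x y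
  else 0

/-- The Green's function is computed by any function with the properties of the regular part. -/
theorem greenFunction_eq {Ω : Set ℂ} (ho : IsOpen Ω) (hb : Bornology.IsBounded Ω)
    {g : ℂ → ℂ → ℝ} (hg : IsGreenRegularPart Ω g) {x y : ℂ} (hx : x ∈ Ω) (hy : y ∈ Ω) :
    greenFunction Ω x y = 1 / (2 * Real.pi) * Real.log ‖x - y‖⁻¹ + g x y := by
  have h : ∃ g, IsGreenRegularPart Ω g := ⟨g, hg⟩
  rw [greenFunction, dif_pos h,
    h.choose_spec.unique ho hb hg x (subset_closure hx) y hy]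

/-- The Lipschitz norm `sup_A |f| + sup_{x ≠ y in A} |f x - f y| / |x - y|`, as an extended
nonnegative number (`∞` if one of the suprema is infinite). -/
noncomputable def lipNorm (A : Set ℂ) (f : ℂ → ℂ) : ENNReal :=
  (⨆ x ∈ A, ‖f x‖ₑ) + ⨆ x ∈ A, ⨆ y ∈ A, ⨆ _ : x ≠ y, ‖f x - f y‖ₑ / ‖x - y‖ₑ

/-- `‖α‖ = max_i |α_i|`. -/
noncomputable def chargeNorm {n : ℕ} (α : Fin n → ℝ) : ℝ := ⨆ i, |α i|

/-- The interaction energy `∑_{k < l} α_k α_l G_Ω(x_k, x_l)`. -/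
noncomputable def coulombEnergy (Ω : Set ℂ) {n : ℕ} (α : Fin n → ℝ) (x : Fin n → ℂ) : ℝ :=
  ∑ k, ∑ l ∈ Finset.Ioi k, α k * α l * greenFunction Ω (x k) (x l)

/-- The integrand of `G_n(x₁)` with `n = m + 1`, as a function of the other points
`x = (x_2, …, x_n)`; the functions `f = (f_2, …, f_n)` are indexed by `Fin m` in the same order. -/
noncomputable def onePointIntegrand (Ω : Set ℂ) {m : ℕ} (α : Fin (m + 1) → ℝ)
    (f : Fin m → ℂ → ℂ) (x₁ : ℂ) (x : Fin m → ℂ) : ℂ :=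
  (∏ j, f j (x j)) *
    (Real.exp (-coulombEnergy Ω α (Fin.cons x₁ x : Fin (m + 1) → ℂ)) : ℂ)

/-- The function `G_n` with `n = m + 1`: the integral over `Ω^{n-1}` of the integrand above. -/
noncomputable def onePointIntegral (Ω : Set ℂ) {m : ℕ} (α : Fin (m + 1) → ℝ)
    (f : Fin m → ℂ → ℂ) (x₁ : ℂ) : ℂ :=
  ∫ x in Set.univ.pi (fun _ : Fin m => Ω), onePointIntegrand Ω α f x₁ x

/-! Write `κ = max |α_i|` and `a = κ^2 / (4π)`, so that `a < 1`. Onsager's electrostatic inequality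
turns the pair interaction into a product over single points. Replace each point charge by a radial
charge on a disc of half its nearest-neighbour distance (capped by `δ`). The discs are disjoint, so
by Newton's theorem the mutual energies do not change. The total field energy is nonnegative, hence
minus the interaction is at most the sum of the self-energies (`neg_coulombEnergy_le`).
Exponentiated, this bounds the Boltzmann factor by `A^n ∏ r_k^(-a)`, where `r_k` is the capped
nearest-neighbour distance (`IsLogKernel.exp_neg_coulombEnergy_le`).

This product is integrated one point at a time. A new point `z` shortens the nearest distance of at
most 25 old points (`card_le_of_nearest`). Each of these except the one closest to `z` changes the
product by a factor at most 2; the closest one, together with the weight of `z` itself, contributes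
`r^a |z - x|^(-2a)`, which is integrable because `a < 1` (`nearestWeight_succ_le`). Cutting at the
typical spacing `n^(-1/2)` and bounding `∑ r_k^2` by packing, one integration costs a constant times
`n^(a/2)` (`lintegral_nearestKernel_le`). Over all the points this gives `C^n n^(a n / 2)`, and `a /
2 = κ^2 / (8π)`.

For the increments, translate all integration variables together with `x₁`. A common translation by
`h` leaves the logarithms unchanged, so only the locally Lipschitz regular part and the `f_j` vary.
When `n^2 |h|` is small, the integrand changes by `O(n^2 |h|)` times the bound already integrated;
for larger `h` the bound on the values suffices. The factor `n^2 ≤ 4^n` disappears into the constant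
(`IsLogKernel.exists_onePointIntegral_bounds`). -/

/-! ### Maximum principle and interior estimate for harmonic functions. -/

/-- Maximum principle for harmonic functions on bounded open sets of the plane. -/
theorem harmonic_le_of_frontier_le {Ω : Set ℂ} (ho : IsOpen Ω) (hb : Bornology.IsBounded Ω)
    {u : ℂ → ℝ} {B : ℝ} (hc : ContinuousOn u (closure Ω)) (hh : HarmonicOnNhd u Ω)
    (h0 : ∀ x ∈ frontier Ω, u x ≤ B) : ∀ x ∈ closure Ω, u x ≤ B := by
  intro x hx
  by_contra! hpos
  have hcomp : IsCompact (closure Ω) := hb.isCompact_closure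
  obtain ⟨p, hp, hpmax⟩ := hcomp.exists_isMaxOn ⟨x, hx⟩ hc
  set M := u p with hM
  have hMpos : B < M := lt_of_lt_of_le hpos (hpmax hx)
  have hSc : IsCompact (closure Ω ∩ u ⁻¹' {M}) :=
    hcomp.of_isClosed_subset (hc.preimage_isClosed_of_isClosed isClosed_closure isClosed_singleton)
      Set.inter_subset_left
  -- Take a maximum point of largest real part. If it is interior, `u` is constant near it by the
  -- maximum modulus principle for `exp F` with `Re F = u`, and a point slightly to its right
  -- contradicts the choice.
  obtain ⟨q, ⟨hq, hqM⟩, hqmax⟩ :=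
    hSc.exists_isMaxOn ⟨p, hp, rfl⟩ Complex.continuous_re.continuousOn
  have hqM' : u q = M := hqM
  have hqΩ : q ∈ Ω := by
    by_contra hn
    have : q ∈ frontier Ω := by
      rw [ho.frontier_eq]; exact ⟨hq, hn⟩
    have := h0 q this
    linarith
  obtain ⟨r, hr, hrΩ⟩ := Metric.isOpen_iff.1 ho q hqΩ
  obtain ⟨F, hF, hFu⟩ := (hh.mono hrΩ).exists_analyticOnNhd_ball_re_eq
  have hev : ∀ᶠ z in 𝓝 q, z ∈ Metric.ball q r := Metric.ball_mem_nhds q hr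
  have hdiff : ∀ᶠ z in 𝓝 q, DifferentiableAt ℂ (fun z => Complex.exp (F z)) z := by
    filter_upwards [hev] with z hz
    exact (hF z hz).differentiableAt.cexp
  have hnorm : ∀ z ∈ Metric.ball q r, ‖Complex.exp (F z)‖ = Real.exp (u z) := by
    intro z hz
    rw [Complex.norm_exp]
    congr 1
    exact hFu hz
  have hloc : IsLocalMax (norm ∘ fun z => Complex.exp (F z)) q := by
    filter_upwards [hev] with z hz
    simp only [Function.comp]
    rw [hnorm z hz, hnorm q (Metric.mem_ball_self hr), Real.exp_le_exp, hqM']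
    exact hpmax (subset_closure (hrΩ hz))
  have hconst := Complex.eventually_eq_of_isLocalMax_norm hdiff hloc
  have hconst' : ∀ᶠ z in 𝓝 q, z ∈ Metric.ball q r ∧ u z = M := by
    filter_upwards [hev, hconst] with z hz hz'
    refine ⟨hz, ?_⟩
    have h1 := hnorm z hz
    rw [hz', hnorm q (Metric.mem_ball_self hr), hqM'] at h1
    exact (Real.exp_injective h1).symm
  obtain ⟨s, hs, hsub⟩ := Metric.eventually_nhds_iff_ball.1 hconst'
  have hmem : q + ((s / 2 : ℝ) : ℂ) ∈ Metric.ball q s := by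
    rw [Metric.mem_ball, dist_eq_norm, add_sub_cancel_left, Complex.norm_real,
      Real.norm_of_nonneg (by positivity)]
    linarith
  obtain ⟨hz1, hz2⟩ := hsub _ hmem
  have hle : (q + ((s / 2 : ℝ) : ℂ)).re ≤ q.re :=
    hqmax (show q + ((s / 2 : ℝ) : ℂ) ∈ closure Ω ∩ u ⁻¹' {M} from
      ⟨subset_closure (hrΩ hz1), hz2⟩)
  rw [Complex.add_re, Complex.ofReal_re] at hle
  linarith

/-- A bounded harmonic function on a disc is Lipschitz at the centre. -/
theorem harmonic_abs_sub_le {h : ℂ → ℝ} {c : ℂ} {δ B : ℝ} (hδ : 0 < δ)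
    (hh : HarmonicOnNhd h (Metric.ball c δ)) (hB : ∀ x ∈ Metric.ball c δ, |h x| ≤ B)
    {x : ℂ} (hx : x ∈ Metric.ball c δ) :
    |h x - h c| ≤ 3 * Real.exp (2 * B) / δ * ‖x - c‖ := by
  obtain ⟨F, hF, hFu⟩ := hh.exists_analyticOnNhd_ball_re_eq
  have hc : c ∈ Metric.ball c δ := Metric.mem_ball_self hδ
  -- The modulus of `exp F` depends on `h` alone, so the Schwarz lemma applies to `exp F` without
  -- control of the harmonic conjugate. The logarithm is undone at the end, at the price of a
  -- further `exp B`.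
  have hnorm : ∀ z ∈ Metric.ball c δ, ‖Complex.exp (F z)‖ = Real.exp (h z) := by
    intro z hz
    rw [Complex.norm_exp]
    congr 1
    exact hFu hz
  have hle : ∀ z ∈ Metric.ball c δ, ‖Complex.exp (F z)‖ ≤ Real.exp B := by
    intro z hz
    rw [hnorm z hz, Real.exp_le_exp]
    exact (abs_le.1 (hB z hz)).2
  have hmaps : Set.MapsTo (fun z => Complex.exp (F z)) (Metric.ball c δ)
      (Metric.ball (Complex.exp (F c)) (3 * Real.exp B)) := by
    intro z hz
    rw [Metric.mem_ball, dist_eq_norm]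
    have := norm_sub_le (Complex.exp (F z)) (Complex.exp (F c))
    have := hle z hz
    have := hle c hc
    have := Real.exp_pos B
    linarith
  have hd : DifferentiableOn ℂ (fun z => Complex.exp (F z)) (Metric.ball c δ) :=
    fun z hz => (hF z hz).differentiableAt.cexp.differentiableWithinAt
  have key := Complex.dist_le_div_mul_dist_of_mapsTo_ball hd
    (hmaps.mono_right Metric.ball_subset_closedBall) hx
  have h1 : |Real.exp (h x) - Real.exp (h c)| ≤ 3 * Real.exp B / δ * ‖x - c‖ := by
    rw [← hnorm x hx, ← hnorm c hc]
    refine (abs_norm_sub_norm_le _ _).trans ?_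
    rw [dist_eq_norm, dist_eq_norm] at key
    exact key
  have hlip : ∀ s t : ℝ, -B ≤ t → s - t ≤ Real.exp B * |Real.exp s - Real.exp t| := by
    intro s t ht
    have h2 : s - t ≤ Real.exp (s - t) - 1 := by linarith [Real.add_one_le_exp (s - t)]
    have h3 : Real.exp (s - t) - 1 = Real.exp (-t) * (Real.exp s - Real.exp t) := by
      rw [mul_sub, ← Real.exp_add, ← Real.exp_add]; simp [sub_eq_neg_add]
    have h4 : Real.exp (-t) * (Real.exp s - Real.exp t)
        ≤ Real.exp (-t) * |Real.exp s - Real.exp t| :=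
      mul_le_mul_of_nonneg_left (le_abs_self _) (Real.exp_pos _).le
    have h5 : Real.exp (-t) * |Real.exp s - Real.exp t|
        ≤ Real.exp B * |Real.exp s - Real.exp t| :=
      mul_le_mul_of_nonneg_right (Real.exp_le_exp.2 (by linarith)) (abs_nonneg _)
    linarith
  have h6 : |h x - h c| ≤ Real.exp B * |Real.exp (h x) - Real.exp (h c)| := by
    rw [abs_le']
    refine ⟨hlip _ _ (abs_le.1 (hB c hc)).1, ?_⟩
    rw [neg_sub, abs_sub_comm]
    exact hlip _ _ (abs_le.1 (hB x hx)).1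
  calc |h x - h c| ≤ Real.exp B * (3 * Real.exp B / δ * ‖x - c‖) :=
        h6.trans (mul_le_mul_of_nonneg_left h1 (Real.exp_pos _).le)
    _ = 3 * Real.exp (2 * B) / δ * ‖x - c‖ := by
        rw [two_mul, Real.exp_add]; ring

/-! ### Bounds and regularity of the regular part of the Green's function. -/

/-- The regular part of the Green's function is bounded above. -/
theorem IsGreenRegularPart.le {Ω : Set ℂ} (ho : IsOpen Ω) (hb : Bornology.IsBounded Ω)
    {g : ℂ → ℂ → ℝ} (hg : IsGreenRegularPart Ω g) {D : ℝ}
    (hD : ∀ x ∈ closure Ω, ∀ y ∈ closure Ω, ‖x - y‖ ≤ D) {x y : ℂ} (hx : x ∈ closure Ω)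
    (hy : y ∈ Ω) : g x y ≤ 1 / (2 * Real.pi) * Real.log D := by
  refine harmonic_le_of_frontier_le ho hb (hg.continuousOn y hy) (hg.harmonic y hy) ?_ x hx
  intro z hz
  rw [hg.boundary y hy z hz, Real.log_inv, mul_neg, neg_neg]
  refine mul_le_mul_of_nonneg_left ?_ (by positivity)
  have hzy : z ≠ y := by
    rintro rfl
    rw [ho.frontier_eq] at hz
    exact hz.2 hy
  exact Real.log_le_log (norm_pos_iff.2 (sub_ne_zero.2 hzy))
    (hD z (frontier_subset_closure hz) y (subset_closure hy))

/-- A boundary point has distance at least `δ` from `y`, so the boundary values are at least the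
claimed bound; the maximum principle for `-g` carries it inside. -/
theorem IsGreenRegularPart.ge {Ω : Set ℂ} (ho : IsOpen Ω) (hb : Bornology.IsBounded Ω)
    {g : ℂ → ℂ → ℝ} (hg : IsGreenRegularPart Ω g) {δ : ℝ} (hδ : 0 < δ) {x y : ℂ}
    (hx : x ∈ closure Ω) (hy : Metric.closedBall y δ ⊆ Ω) :
    1 / (2 * Real.pi) * Real.log δ ≤ g x y := by
  have hyΩ : y ∈ Ω := hy (Metric.mem_closedBall_self hδ.le)
  have := harmonic_le_of_frontier_le (u := -fun x => g x y)
    (B := -(1 / (2 * Real.pi) * Real.log δ)) ho hb (hg.continuousOn y hyΩ).neg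
    (hg.harmonic y hyΩ).neg ?_ x hx
  · simpa using this
  intro z hz
  have hzΩ : z ∉ Ω := by
    rw [ho.frontier_eq] at hz
    exact hz.2
  have hzy : δ ≤ ‖z - y‖ := by
    by_contra! h
    exact hzΩ (hy (by rw [Metric.mem_closedBall, dist_eq_norm]; exact h.le))
  simp only [Pi.neg_apply, hg.boundary y hyΩ z hz, Real.log_inv]
  have := mul_le_mul_of_nonneg_left (Real.log_le_log hδ hzy)
    (by positivity : 0 ≤ 1 / (2 * Real.pi))
  linarith

/-- Local joint Lipschitz continuity of the regular part of the Green's function. -/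
theorem IsGreenRegularPart.exists_lipschitz {Ω : Set ℂ} (ho : IsOpen Ω)
    (hb : Bornology.IsBounded Ω) {g : ℂ → ℂ → ℝ} (hg : IsGreenRegularPart Ω g) {δ : ℝ}
    (hδ : 0 < δ) :
    ∃ L : ℝ, 0 ≤ L ∧ ∀ x y x' y' : ℂ, Metric.closedBall x (2 * δ) ⊆ Ω →
      Metric.closedBall y (2 * δ) ⊆ Ω → ‖x' - x‖ < δ → ‖y' - y‖ < δ →
      |g x' y' - g x y| ≤ L * (‖x' - x‖ + ‖y' - y‖) := by
  obtain ⟨D, hD⟩ : ∃ D : ℝ, ∀ x ∈ closure Ω, ∀ y ∈ closure Ω, ‖x - y‖ ≤ D :=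
    ⟨Metric.diam (closure Ω), fun x hx y hy => by
      rw [← dist_eq_norm]; exact Metric.dist_le_diam_of_mem hb.closure hx hy⟩
  set B := max (1 / (2 * Real.pi) * Real.log D) (-(1 / (2 * Real.pi) * Real.log δ)) with hBdef
  have hbd : ∀ x ∈ Ω, ∀ y, Metric.closedBall y δ ⊆ Ω → |g x y| ≤ B := by
    intro x hx y hy
    have h1 := hg.le ho hb hD (subset_closure hx) (hy (Metric.mem_closedBall_self hδ.le))
    have h2 := hg.ge ho hb hδ (subset_closure hx) hy
    rw [abs_le]
    constructor
    · have := le_max_right (1 / (2 * Real.pi) * Real.log D) (-(1 / (2 * Real.pi) * Real.log δ))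
      linarith
    · exact h1.trans (le_max_left _ _)
  have hone : ∀ x x' y, Metric.closedBall x (2 * δ) ⊆ Ω → Metric.closedBall y δ ⊆ Ω →
      ‖x' - x‖ < δ → |g x' y - g x y| ≤ 3 * Real.exp (2 * B) / δ * ‖x' - x‖ := by
    intro x x' y hx hy hxx
    have hsub : Metric.ball x δ ⊆ Ω := fun z hz => hx (by
      rw [Metric.mem_closedBall]; rw [Metric.mem_ball] at hz; linarith)
    exact harmonic_abs_sub_le hδ
      ((hg.harmonic y (hy (Metric.mem_closedBall_self hδ.le))).mono hsub)
      (fun z hz => hbd z (hsub hz) y hy) (by rwa [Metric.mem_ball, dist_eq_norm])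
  have hsmall : ∀ x x', Metric.closedBall x (2 * δ) ⊆ Ω → ‖x' - x‖ < δ →
      Metric.closedBall x' δ ⊆ Ω := by
    intro x x' hx hxx z hz
    apply hx
    rw [Metric.mem_closedBall] at *
    have := dist_triangle z x' x
    rw [dist_eq_norm x' x] at this
    linarith
  refine ⟨3 * Real.exp (2 * B) / δ, by positivity, ?_⟩
  intro x y x' y' hx hy hxx hyy
  have hx' := hsmall x x' hx hxx
  have hy' := hsmall y y' hy hyy
  have hxs := hsmall x x hx (by simpa)
  have hmem : ∀ {z}, Metric.closedBall z δ ⊆ Ω → z ∈ Ω :=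
    fun h => h (Metric.mem_closedBall_self hδ.le)
  -- Move the first variable with the second held at `y'`, then the second variable, which symmetry
  -- turns into a first one.
  have h1 := hone x x' y' hx hy' hxx
  have h2 := hone y y' x hy hxs hyy
  rw [hg.symm y' (hmem hy') x (hmem hxs), hg.symm y (hmem (hsmall y y hy (by simpa))) x
    (hmem hxs)] at h2
  have h3 := abs_sub_le (g x' y') (g x y') (g x y)
  linarith

/-- The regular part of the Green's function is jointly continuous. -/
theorem IsGreenRegularPart.continuousOn_uncurry {Ω : Set ℂ} (ho : IsOpen Ω)
    (hb : Bornology.IsBounded Ω) {g : ℂ → ℂ → ℝ} (hg : IsGreenRegularPart Ω g) :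
    ContinuousOn (Function.uncurry g) (Ω ×ˢ Ω) := by
  rintro ⟨x, y⟩ ⟨hx, hy⟩
  obtain ⟨r, hr, hrx⟩ := Metric.nhds_basis_closedBall.mem_iff.1 (ho.mem_nhds hx)
  obtain ⟨s, hs, hsy⟩ := Metric.nhds_basis_closedBall.mem_iff.1 (ho.mem_nhds hy)
  have hδ : 0 < min r s / 2 := by positivity
  obtain ⟨L, hL, hLip⟩ := hg.exists_lipschitz ho hb hδ
  apply ContinuousAt.continuousWithinAt
  rw [Metric.continuousAt_iff]
  intro ε hε
  refine ⟨min (min r s / 2) (ε / (2 * L + 1)), by positivity, ?_⟩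
  rintro ⟨x', y'⟩ h
  rw [Prod.dist_eq, max_lt_iff, lt_min_iff, lt_min_iff, dist_eq_norm, dist_eq_norm] at h
  obtain ⟨⟨h1, h2⟩, h3, h4⟩ := h
  have := hLip x y x' y'
    ((Metric.closedBall_subset_closedBall (by linarith [min_le_left r s])).trans hrx)
    ((Metric.closedBall_subset_closedBall (by linarith [min_le_right r s])).trans hsy) h1 h3
  rw [Real.dist_eq]
  refine this.trans_lt ?_
  rw [lt_div_iff₀ (by positivity)] at h2 h4
  simp only at h2 h4
  have h5 := norm_nonneg (x' - x)
  have h6 := norm_nonneg (y' - y)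
  nlinarith

/-! ### Positivity of the Dirichlet energy. -/

theorem continuous_mul_of_tsupport_subset {Ω : Set ℂ} (ho : IsOpen Ω) {w h : ℂ → ℝ}
    (hw : Continuous w) (hs : tsupport w ⊆ Ω) (hh : ContinuousOn h Ω) :
    Continuous fun x => w x * h x := by
  refine continuous_of_tsupport fun x hx => ?_
  have hxΩ : x ∈ Ω := hs (closure_mono (Function.support_mul_subset_left w h) hx)
  exact hw.continuousAt.mul (hh.continuousAt (ho.mem_nhds hxΩ))

theorem laplacian_eq_fderiv_fderiv (u : ℂ → ℝ) (x : ℂ) :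
    Laplacian.laplacian u x =
      fderiv ℝ (fderiv ℝ u) x 1 1 + fderiv ℝ (fderiv ℝ u) x Complex.I Complex.I := by
  simp [laplacian_eq_iteratedFDeriv_complexPlane, iteratedFDeriv_two_apply]

theorem ContDiffOn.continuousOn_laplacian {Ω : Set ℂ} (ho : IsOpen Ω) {u : ℂ → ℝ}
    (hu : ContDiffOn ℝ 2 u Ω) : ContinuousOn (Laplacian.laplacian u) Ω := by
  have h1 : ContDiffOn ℝ 1 (fderiv ℝ u) Ω := hu.fderiv_of_isOpen ho (by norm_num)
  have h2 : ContinuousOn (fderiv ℝ (fderiv ℝ u)) Ω := h1.continuousOn_fderiv_of_isOpen ho le_rfl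
  have h3 : Laplacian.laplacian u = fun x =>
      fderiv ℝ (fderiv ℝ u) x 1 1 + fderiv ℝ (fderiv ℝ u) x Complex.I Complex.I :=
    funext (laplacian_eq_fderiv_fderiv u)
  rw [h3]
  fun_prop

/-- Green's first identity for a compactly supported test function, in the form of an
inequality. -/
theorem integral_mul_laplacian_nonpos {Ω : Set ℂ} (ho : IsOpen Ω) {w u : ℂ → ℝ}
    (hw : ContDiff ℝ 1 w) (hc : HasCompactSupport w) (hs : tsupport w ⊆ Ω)
    (hu : ContDiffOn ℝ 2 u Ω)
    (hnn : ∀ x ∈ Ω, ∀ v, 0 ≤ fderiv ℝ w x v * fderiv ℝ u x v) :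
    ∫ x, w x * Laplacian.laplacian u x ≤ 0 := by
  have h1 : ContDiffOn ℝ 1 (fderiv ℝ u) Ω := hu.fderiv_of_isOpen ho (by norm_num)
  have h2 : ContinuousOn (fderiv ℝ (fderiv ℝ u)) Ω := h1.continuousOn_fderiv_of_isOpen ho le_rfl
  have hd : ∀ x ∈ Ω, DifferentiableAt ℝ (fderiv ℝ u) x := fun x hx =>
    (h1.differentiableOn (by norm_num)).differentiableAt (ho.mem_nhds hx)
  have hdv : ∀ x ∈ Ω, ∀ v, fderiv ℝ (fun y => fderiv ℝ u y v) x v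
      = fderiv ℝ (fderiv ℝ u) x v v := by
    intro x hx v
    rw [fderiv_clm_apply (hd x hx) (differentiableAt_const v)]
    simp
  have hw0 : ∀ x, x ∉ Ω → w x = 0 := fun x hx => image_eq_zero_of_notMem_tsupport fun h => hx (hs h)
  have hfw0 : ∀ x, x ∉ Ω → fderiv ℝ w x = 0 := fun x hx =>
    image_eq_zero_of_notMem_tsupport fun h => hx (hs (tsupport_fderiv_subset ℝ h))
  have hwc := hw.continuous
  have hfw : Continuous (fderiv ℝ w) := hw.continuous_fderiv (by norm_num)
  have hint : ∀ h : ℂ → ℝ, ContinuousOn h Ω → Integrable fun x => w x * h x := fun h hh =>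
    (continuous_mul_of_tsupport_subset ho hwc hs hh).integrable_of_hasCompactSupport hc.mul_right
  have hint' : ∀ v, Integrable fun x => fderiv ℝ w x v * fderiv ℝ u x v := fun v => by
    have hcv : HasCompactSupport fun x => fderiv ℝ w x v :=
      hc.fderiv_apply ℝ v
    refine (continuous_mul_of_tsupport_subset ho (by fun_prop)
      ?_ ?_).integrable_of_hasCompactSupport hcv.mul_right
    · refine (tsupport_fderiv_apply_subset ℝ v).trans hs
    · exact h1.continuousOn.clm_apply continuousOn_const
  have hparts : ∀ v, Integrable (fun x => w x * fderiv ℝ (fderiv ℝ u) x v v) ∧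
      ∫ x, w x * fderiv ℝ (fderiv ℝ u) x v v ≤ 0 := by
    intro v
    have e : (fun x => w x * fderiv ℝ (fderiv ℝ u) x v v)
        = fun x => w x * fderiv ℝ (fun y => fderiv ℝ u y v) x v := by
      funext x
      by_cases hx : x ∈ Ω
      · rw [hdv x hx]
      · simp [hw0 x hx]
    have hi : Integrable (fun x => w x * fderiv ℝ (fderiv ℝ u) x v v) :=
      hint _ ((h2.clm_apply continuousOn_const).clm_apply continuousOn_const)
    refine ⟨hi, ?_⟩
    rw [e] at hi ⊢
    -- Integration by parts on the whole plane, one direction at a time; there is no boundary term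
    -- because `w` has compact support in `Ω`.
    rw [integral_mul_fderiv_eq_neg_fderiv_mul_of_integrable (hint' v) hi
      (hint _ (h1.continuousOn.clm_apply continuousOn_const))
      (fun x _ => hw.differentiable (by norm_num) x)
      (fun x hx => (hd x (hs hx)).clm_apply (differentiableAt_const v))]
    rw [neg_nonpos]
    refine integral_nonneg fun x => ?_
    by_cases hx : x ∈ Ω
    · exact hnn x hx v
    · simp [hfw0 x hx]
  have e : (fun x => w x * Laplacian.laplacian u x) = fun x =>
      w x * fderiv ℝ (fderiv ℝ u) x 1 1 +
        w x * fderiv ℝ (fderiv ℝ u) x Complex.I Complex.I := by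
    funext x
    rw [laplacian_eq_fderiv_fderiv, mul_add]
  rw [e, integral_add (hparts 1).1 (hparts Complex.I).1]
  linarith [(hparts 1).2, (hparts Complex.I).2]

/-- A smooth nondecreasing function that vanishes near `0` and is uniformly close to the
identity. -/
noncomputable def softThreshold (ε t : ℝ) : ℝ := t * Real.smoothTransition (t ^ 2 / ε ^ 2 - 1)

theorem softThreshold_contDiff (ε : ℝ) : ContDiff ℝ 1 (softThreshold ε) := by
  unfold softThreshold
  have : ContDiff ℝ 1 Real.smoothTransition := Real.smoothTransition.contDiff (n := 1)
  refine contDiff_id.mul (this.comp ?_)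
  fun_prop

/-- Since the argument of the transition is even in `t`, its derivative carries a factor `t`, which
combines with the outer factor to `t ^ 2`. -/
theorem softThreshold_deriv_nonneg (ε t : ℝ) : 0 ≤ deriv (softThreshold ε) t := by
  have hs : DifferentiableAt ℝ Real.smoothTransition (t ^ 2 / ε ^ 2 - 1) :=
    (Real.smoothTransition.contDiff (n := 1)).differentiable (by norm_num) _
  have h1 : HasDerivAt (fun t : ℝ => t ^ 2 / ε ^ 2 - 1) (2 * t / ε ^ 2) t := by
    simpa using ((hasDerivAt_pow 2 t).div_const (ε ^ 2)).sub_const 1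
  have h2 := (hasDerivAt_id t).mul (hs.hasDerivAt.comp t h1)
  have h3 : deriv (softThreshold ε) t = _ := h2.deriv
  rw [h3]
  simp only [id, Function.comp, one_mul]
  have h4 := Real.smoothTransition.monotone.deriv_nonneg (x := t ^ 2 / ε ^ 2 - 1)
  have h5 := Real.smoothTransition.nonneg (t ^ 2 / ε ^ 2 - 1)
  have h6 : t * (deriv Real.smoothTransition (t ^ 2 / ε ^ 2 - 1) * (2 * t / ε ^ 2))
      = deriv Real.smoothTransition (t ^ 2 / ε ^ 2 - 1) * (2 * t ^ 2 / ε ^ 2) := by ring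
  rw [h6]
  positivity

theorem softThreshold_eq_zero {ε t : ℝ} (hε : 0 < ε) (h : |t| ≤ ε) : softThreshold ε t = 0 := by
  unfold softThreshold
  rw [Real.smoothTransition.zero_of_nonpos, mul_zero]
  rw [sub_nonpos, div_le_one (by positivity)]
  exact sq_le_sq' (abs_le.1 h).1 (abs_le.1 h).2

theorem abs_softThreshold_sub_le {ε : ℝ} (hε : 0 < ε) (t : ℝ) :
    |softThreshold ε t - t| ≤ 2 * ε := by
  by_cases h : |t| ≤ 2 * ε
  · have h1 := Real.smoothTransition.nonneg (t ^ 2 / ε ^ 2 - 1)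
    have h2 := Real.smoothTransition.le_one (t ^ 2 / ε ^ 2 - 1)
    have : softThreshold ε t - t = t * (Real.smoothTransition (t ^ 2 / ε ^ 2 - 1) - 1) := by
      unfold softThreshold; ring
    rw [this, abs_mul]
    have h3 : |Real.smoothTransition (t ^ 2 / ε ^ 2 - 1) - 1| ≤ 1 := by
      rw [abs_le]; constructor <;> linarith
    nlinarith [abs_nonneg t]
  · push Not at h
    unfold softThreshold
    rw [Real.smoothTransition.one_of_one_le]
    · simp; positivity
    have : (2 * ε) ^ 2 ≤ t ^ 2 := by
      rw [← sq_abs t]; gcongr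
    rw [le_sub_iff_add_le, le_div_iff₀ (by positivity)]
    nlinarith

/-- Positivity of the Dirichlet energy: no regularity of the boundary is needed. -/
theorem setIntegral_mul_laplacian_nonpos {Ω : Set ℂ} (ho : IsOpen Ω)
    (hb : Bornology.IsBounded Ω) {u : ℂ → ℝ} (hu : ContDiffOn ℝ 2 u Ω)
    (hc : ContinuousOn u (closure Ω)) (h0 : ∀ x ∈ frontier Ω, u x = 0)
    (hint : IntegrableOn (Laplacian.laplacian u) Ω) :
    ∫ x in Ω, u x * Laplacian.laplacian u x ≤ 0 := by
  have hcomp : IsCompact (closure Ω) := hb.isCompact_closure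
  obtain ⟨B, hB⟩ := hcomp.exists_bound_of_continuousOn hc
  have huΩ : AEStronglyMeasurable u (volume.restrict Ω) :=
    hu.continuousOn.aestronglyMeasurable ho.measurableSet
  have hintu : IntegrableOn (fun x => u x * Laplacian.laplacian u x) Ω :=
    hint.bdd_mul huΩ (c := B) ((ae_restrict_mem ho.measurableSet).mono fun x hx =>
      hB x (subset_closure hx))
  set N := ∫ x in Ω, ‖Laplacian.laplacian u x‖ with hN
  have hNnn : 0 ≤ N := integral_nonneg fun x => norm_nonneg _
  have key : ∀ ε > 0, ∫ x in Ω, u x * Laplacian.laplacian u x ≤ 2 * ε * N := by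
    intro ε hε
    set w : ℂ → ℝ := Ω.indicator fun x => softThreshold ε (u x) with hwdef
    -- As `u` vanishes on the frontier, the set where `|u| ≥ ε` is a compact subset of `Ω`.
    -- Truncating `u` below `ε` thus yields an admissible test function, whose gradient is a
    -- nonnegative multiple of that of `u`, with uniform error `2 * ε`.
    set Kε : Set ℂ := closure Ω ∩ u ⁻¹' {t | ε ≤ |t|} with hKε
    have hKcl : IsClosed Kε := hc.preimage_isClosed_of_isClosed isClosed_closure
      (isClosed_le continuous_const continuous_abs)
    have hKc : IsCompact Kε := hcomp.of_isClosed_subset hKcl Set.inter_subset_left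
    have hKΩ : Kε ⊆ Ω := by
      intro x hx
      by_contra hn
      have : x ∈ frontier Ω := by rw [ho.frontier_eq]; exact ⟨hx.1, hn⟩
      have h2 := hx.2
      simp only [Set.mem_preimage, Set.mem_ofPred_eq, h0 x this, abs_zero] at h2
      linarith
    have hsupp : Function.support w ⊆ Kε := by
      intro x hx
      have hxΩ : x ∈ Ω := Set.mem_of_indicator_ne_zero hx
      refine ⟨subset_closure hxΩ, ?_⟩
      by_contra hn
      simp only [Set.mem_preimage, Set.mem_ofPred_eq, not_le] at hn
      apply hx
      simp [hwdef, hxΩ, softThreshold_eq_zero hε hn.le]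
    have hts : tsupport w ⊆ Kε := closure_minimal hsupp hKcl
    have hwc : HasCompactSupport w := hKc.of_isClosed_subset (isClosed_tsupport _) hts
    have hweq : ∀ x ∈ Ω, w =ᶠ[𝓝 x] fun x => softThreshold ε (u x) := fun x hx => by
      filter_upwards [ho.mem_nhds hx] with y hy
      simp [hwdef, hy]
    have hw : ContDiff ℝ 1 w := by
      rw [contDiff_iff_contDiffAt]
      intro x
      by_cases hx : x ∈ Ω
      · refine ContDiffAt.congr_of_eventuallyEq ?_ (hweq x hx)
        exact (softThreshold_contDiff ε).contDiffAt.comp x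
          (((hu x hx).contDiffAt (ho.mem_nhds hx)).of_le (by norm_num))
      · have hx' : x ∉ tsupport w := fun h => hx (hKΩ (hts h))
        exact contDiffAt_const.congr_of_eventuallyEq (notMem_tsupport_iff_eventuallyEq.1 hx')
    have hnn : ∀ x ∈ Ω, ∀ v, 0 ≤ fderiv ℝ w x v * fderiv ℝ u x v := by
      intro x hx v
      have hux : DifferentiableAt ℝ u x :=
        ((hu x hx).contDiffAt (ho.mem_nhds hx)).differentiableAt (by norm_num)
      have hφ : DifferentiableAt ℝ (softThreshold ε) (u x) :=
        (softThreshold_contDiff ε).differentiable (by norm_num) _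
      have h3 := hφ.hasDerivAt.comp_hasFDerivAt x hux.hasFDerivAt
      have h4 : fderiv ℝ w x = deriv (softThreshold ε) (u x) • fderiv ℝ u x := by
        rw [(hweq x hx).fderiv_eq]
        exact h3.fderiv
      rw [h4]
      simp only [smul_apply, smul_eq_mul, mul_assoc]
      exact mul_nonneg (softThreshold_deriv_nonneg _ _) (mul_self_nonneg _)
    have h1 := integral_mul_laplacian_nonpos ho hw hwc (hts.trans hKΩ) hu hnn
    have h2 : ∫ x, w x * Laplacian.laplacian u x
        = ∫ x in Ω, w x * Laplacian.laplacian u x := by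
      rw [setIntegral_eq_integral_of_forall_compl_eq_zero]
      intro x hx
      simp [hwdef, hx]
    have hintw : IntegrableOn (fun x => w x * Laplacian.laplacian u x) Ω :=
      ((continuous_mul_of_tsupport_subset ho hw.continuous (hts.trans hKΩ)
        (hu.continuousOn_laplacian ho)).integrable_of_hasCompactSupport
          hwc.mul_right).integrableOn
    have h3 : ∫ x in Ω, u x * Laplacian.laplacian u x
        - w x * Laplacian.laplacian u x ≤ ∫ x in Ω, 2 * ε * ‖Laplacian.laplacian u x‖ := by
      refine setIntegral_mono_on (hintu.sub hintw) (hint.norm.const_mul _) ho.measurableSet ?_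
      intro x hx
      have hwx : w x = softThreshold ε (u x) := by simp [hwdef, hx]
      rw [← sub_mul, hwx]
      refine (le_abs_self _).trans ?_
      rw [abs_mul, abs_sub_comm, Real.norm_eq_abs]
      exact mul_le_mul_of_nonneg_right (abs_softThreshold_sub_le hε _) (abs_nonneg _)
    rw [integral_sub hintu hintw, integral_const_mul, ← hN] at h3
    linarith
  by_contra! hpos
  -- This `ε` makes the error at most half of the supposedly positive integral; `N + 1` guards
  -- against `N = 0`.
  have := key ((∫ x in Ω, u x * Laplacian.laplacian u x) / (4 * (N + 1))) (by positivity)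
  set T := ∫ x in Ω, u x * Laplacian.laplacian u x
  have h5 : 2 * (T / (4 * (N + 1))) * N ≤ T / 2 := by
    have : 2 * (T / (4 * (N + 1))) * N = T / 2 * (N / (N + 1)) := by field_simp; ring
    rw [this]
    have : N / (N + 1) ≤ 1 := (div_le_one (by positivity)).2 (by linarith)
    nlinarith
  linarith

/-! ### A twice differentiable cutoff of the logarithmic potential. -/

/-- At the joint both one-sided derivatives equal `d`, so only the values have to match. It is used
for `cutoffLog` and again for its derivative: the inner piece is the second Taylor polynomial of the
logarithm at `1`. -/
theorem hasDerivAt_ite_lt {f₁ f₂ : ℝ → ℝ} {a d s : ℝ} (h₁ : s ≤ a → HasDerivAt f₁ d s)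
    (h₂ : a ≤ s → HasDerivAt f₂ d s) (h : f₁ a = f₂ a) :
    HasDerivAt (fun t => if t < a then f₁ t else f₂ t) d s := by
  rcases lt_trichotomy s a with hs | hs | hs
  · refine (h₁ hs.le).congr_of_eventuallyEq ?_
    filter_upwards [Iio_mem_nhds hs] with t ht
    simp [Set.mem_Iio.1 ht]
  · subst hs
    rw [← hasDerivWithinAt_univ, ← Set.Iic_union_Ici (a := s)]
    refine HasDerivWithinAt.union ?_ ?_
    · refine (h₁ le_rfl).hasDerivWithinAt.congr (fun t ht => ?_) (by simp [h])
      rcases (Set.mem_Iic.1 ht).lt_or_eq with h' | h'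
      · simp [h']
      · simp [h', h]
    · refine (h₂ le_rfl).hasDerivWithinAt.congr (fun t ht => ?_) (by simp)
      simp [not_lt.2 (Set.mem_Ici.1 ht)]
  · refine (h₂ hs.le).congr_of_eventuallyEq ?_
    filter_upwards [Ioi_mem_nhds hs] with t ht
    simp [not_lt.2 (Set.mem_Ioi.1 ht).le]

/-- A `C²` function that agrees with the logarithm on `[1, ∞)`. -/
noncomputable def cutoffLog (s : ℝ) : ℝ :=
  if s < 1 then (s - 1) - (s - 1) ^ 2 / 2 else Real.log s

noncomputable def cutoffLogDeriv (s : ℝ) : ℝ := if s < 1 then 2 - s else s⁻¹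

noncomputable def cutoffLogDerivTwo (s : ℝ) : ℝ := if s < 1 then -1 else -(s ^ 2)⁻¹

theorem cutoffLog_hasDerivAt (s : ℝ) : HasDerivAt cutoffLog (cutoffLogDeriv s) s := by
  refine hasDerivAt_ite_lt (fun hs => ?_) (fun hs => ?_) (by simp)
  · have h1 : HasDerivAt (fun t : ℝ => t - 1) 1 s := (hasDerivAt_id s).sub_const 1
    have h2 := h1.sub ((h1.pow 2).div_const 2)
    refine h2.congr_deriv ?_
    unfold cutoffLogDeriv
    split_ifs with h
    · simp; ring
    · have : s = 1 := le_antisymm hs (not_lt.1 h)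
      simp [this]
  · have := Real.hasDerivAt_log (x := s) (by linarith)
    simpa [cutoffLogDeriv, not_lt.2 hs] using this

theorem cutoffLogDeriv_hasDerivAt (s : ℝ) :
    HasDerivAt cutoffLogDeriv (cutoffLogDerivTwo s) s := by
  refine hasDerivAt_ite_lt (fun hs => ?_) (fun hs => ?_) (by norm_num)
  · have h1 := (hasDerivAt_id s).const_sub 2
    refine h1.congr_deriv ?_
    unfold cutoffLogDerivTwo
    split_ifs with h
    · rfl
    · have : s = 1 := le_antisymm hs (not_lt.1 h)
      simp [this]
  · have := hasDerivAt_inv (x := s) (by linarith)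
    simpa [cutoffLogDerivTwo, not_lt.2 hs] using this

theorem cutoffLogDerivTwo_continuous : Continuous cutoffLogDerivTwo := by
  have : cutoffLogDerivTwo = fun s => -((max s 1) ^ 2)⁻¹ := by
    funext s
    unfold cutoffLogDerivTwo
    split_ifs with h
    · simp [max_eq_right h.le]
    · simp [max_eq_left (not_lt.1 h)]
  rw [this]
  refine ((continuous_id.max continuous_const).pow 2).inv₀ (fun s => ?_) |>.neg
  have : (0 : ℝ) < max s 1 := lt_of_lt_of_le one_pos (le_max_right _ _)
  exact (pow_pos this 2).ne'

theorem cutoffLog_contDiff : ContDiff ℝ 2 cutoffLog := by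
  have h1 : ContDiff ℝ 1 cutoffLogDeriv := by
    rw [contDiff_one_iff_deriv]
    refine ⟨fun s => (cutoffLogDeriv_hasDerivAt s).differentiableAt, ?_⟩
    rw [funext fun s => (cutoffLogDeriv_hasDerivAt s).deriv]
    exact cutoffLogDerivTwo_continuous
  rw [show (2 : WithTop ℕ∞) = 1 + 1 from rfl, contDiff_succ_iff_deriv]
  refine ⟨fun s => (cutoffLog_hasDerivAt s).differentiableAt, by simp, ?_⟩
  rw [funext fun s => (cutoffLog_hasDerivAt s).deriv]
  exact h1

/-- Up to constants, the logarithmic potential of a charge smeared over the disc of radius `r`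
around `c`. -/
noncomputable def smearedLog (c : ℂ) (r : ℝ) (x : ℂ) : ℝ := cutoffLog (‖x - c‖ ^ 2 / r ^ 2)

/-- A radial probability density on the disc of radius `r` around `c`. -/
noncomputable def smearedDensity (c : ℂ) (r : ℝ) (x : ℂ) : ℝ :=
  2 / (Real.pi * r ^ 2) * (1 - ‖x - c‖ ^ 2 / r ^ 2)

theorem smearedLog_contDiff (c : ℂ) (r : ℝ) : ContDiff ℝ 2 (smearedLog c r) := by
  refine cutoffLog_contDiff.comp (ContDiff.div_const ?_ _)
  exact (contDiff_id.sub contDiff_const).norm_sq ℝ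

theorem sq_norm_div_lt_one_iff {c x : ℂ} {r : ℝ} (hr : 0 < r) :
    ‖x - c‖ ^ 2 / r ^ 2 < 1 ↔ x ∈ Metric.ball c r := by
  rw [Metric.mem_ball, dist_eq_norm, div_lt_one (by positivity),
    sq_lt_sq₀ (norm_nonneg _) hr.le]

theorem smearedLog_of_le {c x : ℂ} {r : ℝ} (hr : 0 < r) (h : r ≤ ‖x - c‖) :
    smearedLog c r x = 2 * Real.log ‖x - c‖ - 2 * Real.log r := by
  have h1 : ¬ ‖x - c‖ ^ 2 / r ^ 2 < 1 := by
    rw [sq_norm_div_lt_one_iff hr, Metric.mem_ball, dist_eq_norm, not_lt]; exact h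
  have h2 : ‖x - c‖ ≠ 0 := by linarith
  rw [smearedLog, cutoffLog, if_neg h1, Real.log_div (by positivity) (by positivity),
    Real.log_pow, Real.log_pow]
  norm_num

theorem smearedLog_ge {c x : ℂ} {r : ℝ} (hr : 0 < r) (h : x ∈ Metric.ball c r) :
    -(3 / 2) ≤ smearedLog c r x := by
  rw [← sq_norm_div_lt_one_iff hr] at h
  rw [smearedLog, cutoffLog, if_pos h]
  have : 0 ≤ ‖x - c‖ ^ 2 / r ^ 2 := by positivity
  nlinarith

/-- For a radial function `φ(s)` with `s = |x - c|^2 / r^2` the Laplacian is `4 / r^2 * (s φ'' +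
φ')`. The bracket vanishes for the logarithm and is `2 * (1 - s)` for its Taylor polynomial, which
is where the density comes from. -/
theorem smearedLog_laplacian {c : ℂ} {r : ℝ} (hr : 0 < r) (x : ℂ) :
    Laplacian.laplacian (smearedLog c r) x =
      4 * Real.pi * (Metric.ball c r).indicator (smearedDensity c r) x := by
  have hs : ∀ x, HasFDerivAt (fun x : ℂ => ‖x - c‖ ^ 2 / r ^ 2)
      ((2 / r ^ 2) • innerSL ℝ (x - c)) x := by
    intro x
    have h1 : HasFDerivAt (fun x : ℂ => x - c) (ContinuousLinearMap.id ℝ ℂ) x :=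
      (hasFDerivAt_id x).sub_const c
    have h2 := h1.norm_sq.mul_const (r ^ 2)⁻¹
    refine h2.congr_fderiv ?_
    ext v
    simp only [ContinuousLinearMap.comp_id, smul_apply, innerSL_apply_apply, smul_eq_mul]
    ring
  have h1 : fderiv ℝ (smearedLog c r) = fun x =>
      (cutoffLogDeriv (‖x - c‖ ^ 2 / r ^ 2) * (2 / r ^ 2)) • innerSL ℝ (x - c) := by
    funext x
    have := (cutoffLog_hasDerivAt (‖x - c‖ ^ 2 / r ^ 2)).comp_hasFDerivAt x (hs x)
    have h2 : fderiv ℝ (smearedLog c r) x = _ := this.fderiv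
    rw [h2, smul_smul]
  have h2 : ∀ v, fderiv ℝ (fderiv ℝ (smearedLog c r)) x v v =
      cutoffLogDerivTwo (‖x - c‖ ^ 2 / r ^ 2) * (2 / r ^ 2) ^ 2 * inner ℝ (x - c) v ^ 2 +
        cutoffLogDeriv (‖x - c‖ ^ 2 / r ^ 2) * (2 / r ^ 2) * inner ℝ v v := by
    intro v
    have hd : DifferentiableAt ℝ (fderiv ℝ (smearedLog c r)) x :=
      ((smearedLog_contDiff c r).fderiv_right (m := 1) (by norm_num)).differentiable
        (by norm_num) x
    have h0 : fderiv ℝ (fun y => fderiv ℝ (smearedLog c r) y v) x v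
        = fderiv ℝ (fderiv ℝ (smearedLog c r)) x v v := by
      rw [fderiv_clm_apply hd (differentiableAt_const v)]
      simp
    have h3 := ((cutoffLogDeriv_hasDerivAt (‖x - c‖ ^ 2 / r ^ 2)).comp_hasFDerivAt x
      (hs x)).mul_const (2 / r ^ 2)
    have h4 := ((hasFDerivAt_id x).sub_const c).inner ℝ (hasFDerivAt_const v x)
    have h5 := h3.mul h4
    have h6 : (fun y => fderiv ℝ (smearedLog c r) y v) = _ := congrArg (fun f y => f y v) h1
    rw [← h0, h6]
    refine (congrArg (fun f => f v) h5.fderiv).trans ?_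
    simp [-Complex.inner, inner_sub_left]
    ring
  have h3 : ‖x - c‖ ^ 2 = inner ℝ (x - c) 1 ^ 2 + inner ℝ (x - c) Complex.I ^ 2 := by
    rw [← Complex.normSq_eq_norm_sq, Complex.normSq_apply]
    simp [Complex.inner]
    ring
  have h4 : inner ℝ Complex.I Complex.I = (1 : ℝ) := by simp
  have h5 : inner ℝ (1 : ℂ) (1 : ℂ) = (1 : ℝ) := by simp
  rw [laplacian_eq_fderiv_fderiv, h2, h2, h4, h5]
  have h6 : ∀ A B : ℝ, A * (2 / r ^ 2) ^ 2 * inner ℝ (x - c) 1 ^ 2 + B * (2 / r ^ 2) * 1 +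
      (A * (2 / r ^ 2) ^ 2 * inner ℝ (x - c) Complex.I ^ 2 + B * (2 / r ^ 2) * 1) =
      4 / r ^ 2 * (A * (‖x - c‖ ^ 2 / r ^ 2) + B) := by
    intro A B
    rw [h3]
    field_simp
    ring
  rw [h6]
  by_cases h : x ∈ Metric.ball c r
  · rw [Set.indicator_of_mem h]
    rw [← sq_norm_div_lt_one_iff hr] at h
    rw [cutoffLogDerivTwo, cutoffLogDeriv, if_pos h, if_pos h, smearedDensity]
    have := Real.pi_pos
    field_simp
    ring
  · rw [Set.indicator_of_notMem h]
    rw [← sq_norm_div_lt_one_iff hr] at h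
    rw [cutoffLogDerivTwo, cutoffLogDeriv, if_neg h, if_neg h]
    have : ‖x - c‖ ^ 2 / r ^ 2 ≠ 0 := by intro h'; rw [h'] at h; norm_num at h
    field_simp
    ring

/-! ### Newton's theorem for smeared charges. -/

/-- The mean value property of harmonic functions for the density `smearedDensity`. -/
theorem integral_smearedDensity_mul {c : ℂ} {r : ℝ} (hr : 0 < r) {h : ℂ → ℝ}
    (hh : HarmonicOnNhd h (Metric.closedBall c r)) :
    ∫ x in Metric.ball c r, smearedDensity c r x * h x = h c := by
  set F : ℂ → ℝ := (Metric.ball c r).indicator fun x => smearedDensity c r x * h x with hF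
  have hmean : ∀ t ∈ Set.Ioc 0 r, ∫ θ in Set.Ioo (-Real.pi) Real.pi,
      h (c + Complex.polarCoord.symm (t, θ)) = 2 * Real.pi * h c := by
    intro t ht
    have h1 : Real.circleAverage h c t = h c := by
      refine InnerProductSpace.HarmonicOnNhd.circleAverage_eq (hh.mono ?_)
      rw [abs_of_pos ht.1]
      exact Metric.closedBall_subset_closedBall ht.2
    have hpi := Real.pi_pos
    have h2 : ∫ θ in (0 : ℝ)..2 * Real.pi, h (circleMap c t θ) = 2 * Real.pi * h c := by
      rw [Real.circleAverage, smul_eq_mul] at h1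
      rw [← h1]
      field_simp
    have h3 : Function.Periodic (fun θ => h (circleMap c t θ)) (2 * Real.pi) := fun θ => by
      simp only [periodic_circleMap c t θ]
    have h4 := h3.intervalIntegral_add_eq 0 (-Real.pi)
    rw [zero_add, h2, show -Real.pi + 2 * Real.pi = Real.pi by ring] at h4
    rw [h4, intervalIntegral.integral_of_le (by linarith), integral_Ioc_eq_integral_Ioo]
    refine integral_congr_ae (Filter.Eventually.of_forall fun θ => ?_)
    simp only [Complex.polarCoord_symm_apply, circleMap, Complex.exp_mul_I]
    push_cast
    rfl
  have hcont : ContinuousOn (fun p : ℝ × ℝ => p.1 *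
      (2 / (Real.pi * r ^ 2) * (1 - p.1 ^ 2 / r ^ 2)) * h (c + Complex.polarCoord.symm p))
      (Set.Icc 0 r ×ˢ Set.Icc (-Real.pi) Real.pi) := by
    refine ContinuousOn.mul (by fun_prop) (hh.continuousOn.comp ?_ ?_)
    · simp only [Complex.polarCoord_symm_apply]
      fun_prop
    · rintro p ⟨hp, -⟩
      rw [Metric.mem_closedBall, dist_eq_norm, add_sub_cancel_left,
        Complex.norm_polarCoord_symm, abs_of_nonneg hp.1]
      exact hp.2
  have hint := hcont.integrableOn_compact (μ := volume) (isCompact_Icc.prod isCompact_Icc)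
  rw [← integral_indicator measurableSet_ball, ← hF, ← integral_add_left_eq_self F c,
    ← Complex.integral_comp_polarCoord_symm]
  have hsub : Set.Ioo 0 r ×ˢ Set.Ioo (-Real.pi) Real.pi ⊆ polarCoord.target := by
    rw [polarCoord_target]
    exact Set.prod_mono Set.Ioo_subset_Ioi_self subset_rfl
  have hpt : ∀ p ∈ Set.Ioi (0 : ℝ) ×ˢ Set.Ioo (-Real.pi) Real.pi,
      p.1 • F (c + Complex.polarCoord.symm p) =
      (Set.Ioo 0 r ×ˢ Set.Ioo (-Real.pi) Real.pi).indicator (fun p : ℝ × ℝ => p.1 *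
      (2 / (Real.pi * r ^ 2) * (1 - p.1 ^ 2 / r ^ 2)) * h (c + Complex.polarCoord.symm p)) p := by
    rintro p ⟨hp1, hp2⟩
    have hp1' : 0 < p.1 := hp1
    have hn : ‖c + Complex.polarCoord.symm p - c‖ = p.1 := by
      rw [add_sub_cancel_left, Complex.norm_polarCoord_symm, abs_of_pos hp1']
    by_cases hpr : p.1 < r
    · have hm : p ∈ Set.Ioo 0 r ×ˢ Set.Ioo (-Real.pi) Real.pi := ⟨⟨hp1', hpr⟩, hp2⟩
      rw [Set.indicator_of_mem hm, hF, Set.indicator_of_mem, smearedDensity, hn,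
        smul_eq_mul]
      · ring
      · rw [Metric.mem_ball, dist_eq_norm, hn]; exact hpr
    · rw [Set.indicator_of_notMem, hF, Set.indicator_of_notMem, smul_zero]
      · rw [Metric.mem_ball, dist_eq_norm, hn]; exact hpr
      · exact fun hp => hpr hp.1.2
  rw [polarCoord_target, setIntegral_congr_fun (measurableSet_Ioi.prod measurableSet_Ioo) hpt,
    setIntegral_indicator (measurableSet_Ioo.prod measurableSet_Ioo),
    Set.inter_eq_right.2 (polarCoord_target ▸ hsub), Measure.volume_eq_prod,
    setIntegral_prod _ (hint.mono_set (Set.prod_mono Set.Ioo_subset_Icc_self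
      Set.Ioo_subset_Icc_self))]
  -- The angular average replaces `h` by `h c`; what remains integrates over `(0, r)` to `(2 - 1) *
  -- h c`, so the density has total mass one.
  have hrad : ∀ t ∈ Set.Ioo 0 r, ∫ θ in Set.Ioo (-Real.pi) Real.pi, t *
      (2 / (Real.pi * r ^ 2) * (1 - t ^ 2 / r ^ 2)) * h (c + Complex.polarCoord.symm (t, θ)) =
      (4 / r ^ 2 * h c) * t - (4 / r ^ 4 * h c) * t ^ 3 := by
    intro t ht
    rw [integral_const_mul, hmean t ⟨ht.1, ht.2.le⟩]
    have := Real.pi_pos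
    field_simp
    ring
  rw [setIntegral_congr_fun measurableSet_Ioo hrad, ← integral_Ioc_eq_integral_Ioo,
    ← intervalIntegral.integral_of_le hr.le, intervalIntegral.integral_sub
      (by apply Continuous.intervalIntegrable; fun_prop)
      (by apply Continuous.intervalIntegrable; fun_prop), intervalIntegral.integral_const_mul,
    intervalIntegral.integral_const_mul, integral_id, integral_pow]
  field_simp
  ring

theorem laplacian_finset_sum {ι : Type*} (s : Finset ι) {F : ι → ℂ → ℝ} {x : ℂ}
    (h : ∀ i ∈ s, ContDiffAt ℝ 2 (F i) x) :
    Laplacian.laplacian (fun y => ∑ i ∈ s, F i y) x = ∑ i ∈ s, Laplacian.laplacian (F i) x := by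
  classical
  induction s using Finset.induction_on with
  | empty => simp
  | insert a s ha ih =>
    have h1 : (fun y => ∑ i ∈ insert a s, F i y) = F a + fun y => ∑ i ∈ s, F i y := by
      funext y; simp [Finset.sum_insert ha]
    rw [h1, ContDiffAt.laplacian_add (h a (Finset.mem_insert_self a s))
      (ContDiffAt.sum fun i hi => h i (Finset.mem_insert_of_mem hi)),
      ih fun i hi => h i (Finset.mem_insert_of_mem hi), Finset.sum_insert ha]

theorem smearedDensity_continuous (c : ℂ) (r : ℝ) : Continuous (smearedDensity c r) := by
  unfold smearedDensity
  fun_prop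

theorem smearedDensity_nonneg {c x : ℂ} {r : ℝ} (hr : 0 < r) (hx : x ∈ Metric.ball c r) :
    0 ≤ smearedDensity c r x := by
  have := (sq_norm_div_lt_one_iff hr).2 hx
  have hpi := Real.pi_pos
  exact mul_nonneg (by positivity) (by linarith)

/-- The potential of a unit charge smeared over the disc of radius `r` around `c`. -/
noncomputable def smearedPotential (g : ℂ → ℂ → ℝ) (c : ℂ) (r : ℝ) (x : ℂ) : ℝ :=
  -(1 / (4 * Real.pi)) * smearedLog c r x - 1 / (2 * Real.pi) * Real.log r + g x c

theorem smearedPotential_of_le (g : ℂ → ℂ → ℝ) {c x : ℂ} {r : ℝ} (hr : 0 < r)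
    (h : r ≤ ‖x - c‖) :
    smearedPotential g c r x = 1 / (2 * Real.pi) * Real.log ‖x - c‖⁻¹ + g x c := by
  have hpi := Real.pi_pos
  rw [smearedPotential, smearedLog_of_le hr h, Real.log_inv]
  field_simp
  ring

section Potential

variable {Ω : Set ℂ} {g : ℂ → ℂ → ℝ} (ho : IsOpen Ω) (hg : IsGreenRegularPart Ω g)
  {c : ℂ} {r : ℝ} (hr : 0 < r) (hball : Metric.closedBall c r ⊆ Ω)

include hr hball in
theorem center_mem_of_closedBall_subset : c ∈ Ω := hball (Metric.mem_closedBall_self hr.le)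

include ho hg hr hball in
theorem smearedPotential_contDiffAt {x : ℂ} (hx : x ∈ Ω) :
    ContDiffAt ℝ 2 (smearedPotential g c r) x := by
  have hc := center_mem_of_closedBall_subset hr hball
  exact ((contDiffAt_const.mul (smearedLog_contDiff c r).contDiffAt).sub contDiffAt_const).add
    (((hg.harmonic c hc).contDiffOn x hx).contDiffAt (ho.mem_nhds hx))

include ho hg hr hball in
theorem smearedPotential_laplacian {x : ℂ} (hx : x ∈ Ω) :
    Laplacian.laplacian (smearedPotential g c r) x =
      -(Metric.ball c r).indicator (smearedDensity c r) x := by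
  have hc := center_mem_of_closedBall_subset hr hball
  have e : smearedPotential g c r = ((-(1 / (4 * Real.pi))) • smearedLog c r) +
      ((fun _ => -(1 / (2 * Real.pi) * Real.log r)) + fun x => g x c) := by
    funext y
    simp only [smearedPotential, Pi.add_apply, Pi.smul_apply, smul_eq_mul]
    ring
  have h1 := (smearedLog_contDiff c r).contDiffAt (x := x)
  have h2 : ContDiffAt ℝ 2 (fun x => g x c) x :=
    ((hg.harmonic c hc).contDiffOn x hx).contDiffAt (ho.mem_nhds hx)
  have h3 : Laplacian.laplacian (fun x => g x c) x = 0 :=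
    (hg.harmonic c hc x hx).2.self_of_nhds
  have hpi := Real.pi_pos
  have h4 : ContDiffAt ℝ 2 ((-(1 / (4 * Real.pi))) • smearedLog c r) x :=
    contDiffAt_const.smul h1
  have h5 : ContDiffAt ℝ 2 ((fun _ => -(1 / (2 * Real.pi) * Real.log r)) + fun x => g x c) x :=
    contDiffAt_const.add h2
  rw [e, ContDiffAt.laplacian_add h4 h5,
    ContDiffAt.laplacian_add contDiffAt_const h2, laplacian_smul _ h1, laplacian_const, h3,
    smearedLog_laplacian hr, smul_eq_mul]
  simp only [Pi.zero_apply, add_zero]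
  field_simp

include hg hr hball in
theorem smearedPotential_continuousOn :
    ContinuousOn (smearedPotential g c r) (closure Ω) := by
  have hc := center_mem_of_closedBall_subset hr hball
  have h1 := (smearedLog_contDiff c r).continuous
  have h2 := hg.continuousOn c hc
  unfold smearedPotential
  fun_prop

include ho hg hr hball in
-- The closed disc lies in `Ω`, so from the boundary the smeared charge looks like a point charge,
-- whose Green's function vanishes there.
theorem smearedPotential_frontier {x : ℂ} (hx : x ∈ frontier Ω) :
    smearedPotential g c r x = 0 := by
  have hc := center_mem_of_closedBall_subset hr hball
  have hxΩ : x ∉ Ω := by rw [ho.frontier_eq] at hx; exact hx.2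
  have : r ≤ ‖x - c‖ := by
    by_contra! h
    exact hxΩ (hball (by rw [Metric.mem_closedBall, dist_eq_norm]; exact h.le))
  rw [smearedPotential_of_le g hr this, hg.boundary c hc x hx]
  ring

include ho hg hr hball in
/-- Newton's theorem for two disjoint smeared charges. -/
theorem integral_smearedDensity_mul_smearedPotential (hb : Bornology.IsBounded Ω) {c' : ℂ}
    {r' : ℝ} (hr' : 0 < r') (hball' : Metric.closedBall c' r' ⊆ Ω) (hsep : r + r' ≤ ‖c - c'‖) :
    ∫ x in Metric.ball c r, smearedDensity c r x * smearedPotential g c' r' x =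
      greenFunction Ω c c' := by
  have hc := center_mem_of_closedBall_subset hr hball
  have hc' := center_mem_of_closedBall_subset hr' hball'
  have hfar : ∀ y ∈ Metric.closedBall c r, r' ≤ ‖y - c'‖ := by
    intro y hy
    rw [Metric.mem_closedBall, dist_eq_norm] at hy
    have := norm_sub_le_norm_sub_add_norm_sub c y c'
    rw [norm_sub_rev c y] at this
    linarith
  -- On the other disc the smeared potential is the Green's function of a point charge at `c'`,
  -- which is harmonic there because the open discs are disjoint. The mean value property then
  -- collapses the second charge to its centre.
  have hharm : HarmonicOnNhd (fun y => 1 / (2 * Real.pi) * Real.log ‖y - c'‖⁻¹ + g y c')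
      (Metric.closedBall c r) := by
    intro y hy
    have hne : y - c' ≠ 0 := norm_pos_iff.1 (hr'.trans_le (hfar y hy))
    have h1 : AnalyticAt ℂ (fun y : ℂ => y - c') y := analyticAt_id.sub analyticAt_const
    have h2 : HarmonicAt (fun y => Real.log ‖y - c'‖) y := h1.harmonicAt_log_norm hne
    have h3 := (h2.const_smul (c := -(1 / (2 * Real.pi)))).add (hg.harmonic c' hc' y (hball hy))
    convert h3 using 1
    funext z
    simp [Real.log_inv]
  rw [greenFunction_eq ho hb hg hc hc', ← integral_smearedDensity_mul hr hharm]
  refine setIntegral_congr_fun measurableSet_ball fun y hy => ?_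
  simp only [smearedPotential_of_le g hr' (hfar y (Metric.ball_subset_closedBall hy))]

include hg hball in
theorem integrableOn_smearedDensity_mul_smearedPotential {c' : ℂ} {r' : ℝ} (hr' : 0 < r')
    (hball' : Metric.closedBall c' r' ⊆ Ω) :
    IntegrableOn (fun x => smearedDensity c r x * smearedPotential g c' r' x)
      (Metric.ball c r) := by
  refine IntegrableOn.mono_set ?_ Metric.ball_subset_closedBall
  refine ContinuousOn.integrableOn_compact (isCompact_closedBall c r) ?_
  exact (smearedDensity_continuous c r).continuousOn.mul
    ((smearedPotential_continuousOn hg hr' hball').mono (hball.trans subset_closure))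

include hg hr hball in
-- Inside the disc the cut-off logarithm is at least `-3/2`; multiplied by `1 / (4π)` this is the
-- term `3 / (8π)`. The remaining upper bound is harmonic, and its mean is its value at the centre.
theorem integral_smearedDensity_mul_smearedPotential_self_le :
    ∫ x in Metric.ball c r, smearedDensity c r x * smearedPotential g c r x ≤
      g c c - 1 / (2 * Real.pi) * Real.log r + 3 / (8 * Real.pi) := by
  have hc := center_mem_of_closedBall_subset hr hball
  have hharm : HarmonicOnNhd (fun y => (3 / (8 * Real.pi) - 1 / (2 * Real.pi) * Real.log r) +
      g y c) (Metric.closedBall c r) :=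
    (harmonicOnNhd_const _).add ((hg.harmonic c hc).mono hball)
  have h1 := integral_smearedDensity_mul hr hharm
  have h2 : g c c - 1 / (2 * Real.pi) * Real.log r + 3 / (8 * Real.pi) =
      3 / (8 * Real.pi) - 1 / (2 * Real.pi) * Real.log r + g c c := by ring
  rw [h2, ← h1]
  refine setIntegral_mono_on
    (integrableOn_smearedDensity_mul_smearedPotential hg hball hr hball) ?_
    measurableSet_ball fun y hy => ?_
  · exact (ContinuousOn.integrableOn_compact (isCompact_closedBall c r)
      ((smearedDensity_continuous c r).continuousOn.mul hharm.continuousOn)).mono_set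
        Metric.ball_subset_closedBall
  refine mul_le_mul_of_nonneg_left ?_ (smearedDensity_nonneg hr hy)
  have h3 := smearedLog_ge hr hy
  have h4 : 1 / (4 * Real.pi) * (-(3 / 2)) ≤ 1 / (4 * Real.pi) * smearedLog c r y :=
    mul_le_mul_of_nonneg_left h3 (by have := Real.pi_pos; positivity)
  have h5 : 1 / (4 * Real.pi) * (-(3 / 2)) = -(3 / (8 * Real.pi)) := by
    have := Real.pi_pos
    field_simp
    norm_num
  simp only [smearedPotential]
  linarith

end Potential

/-! ### Onsager's electrostatic inequality. -/

theorem greenFunction_comm {Ω : Set ℂ} (ho : IsOpen Ω) (hb : Bornology.IsBounded Ω)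
    {g : ℂ → ℂ → ℝ} (hg : IsGreenRegularPart Ω g) {x y : ℂ} (hx : x ∈ Ω) (hy : y ∈ Ω) :
    greenFunction Ω x y = greenFunction Ω y x := by
  rw [greenFunction_eq ho hb hg hx hy, greenFunction_eq ho hb hg hy hx, norm_sub_rev,
    hg.symm x hx y hy]

/-- Onsager's electrostatic inequality. -/
theorem neg_coulombEnergy_le {Ω : Set ℂ} (ho : IsOpen Ω) (hb : Bornology.IsBounded Ω)
    {g : ℂ → ℂ → ℝ} (hg : IsGreenRegularPart Ω g) {n : ℕ} (α : Fin n → ℝ) (x : Fin n → ℂ)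
    (r : Fin n → ℝ) (hr : ∀ k, 0 < r k) (hball : ∀ k, Metric.closedBall (x k) (r k) ⊆ Ω)
    (hsep : ∀ k l, k ≠ l → r k + r l ≤ ‖x k - x l‖) :
    -coulombEnergy Ω α x ≤ 1 / 2 * ∑ k, α k ^ 2 *
      (g (x k) (x k) - 1 / (2 * Real.pi) * Real.log (r k) + 3 / (8 * Real.pi)) := by
  set U : Fin n → ℂ → ℝ := fun l => smearedPotential g (x l) (r l) with hU
  set u : ℂ → ℝ := fun y => ∑ l, α l * U l y with hu
  have hUd : ∀ l, ∀ y ∈ Ω, ContDiffAt ℝ 2 (U l) y := fun l y hy =>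
    smearedPotential_contDiffAt ho hg (hr l) (hball l) hy
  have huC : ContDiffOn ℝ 2 u Ω := fun y hy =>
    (ContDiffAt.sum fun l _ => contDiffAt_const.mul (hUd l y hy)).contDiffWithinAt
  have hucont : ContinuousOn u (closure Ω) :=
    continuousOn_finsetSum _ fun l _ => continuousOn_const.mul
      (smearedPotential_continuousOn hg (hr l) (hball l))
  have hu0 : ∀ y ∈ frontier Ω, u y = 0 := fun y hy =>
    Finset.sum_eq_zero fun l _ => by
      simp only [hU]
      rw [smearedPotential_frontier ho hg (hr l) (hball l) hy, mul_zero]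
  have hlap : ∀ y ∈ Ω, Laplacian.laplacian u y = ∑ k, -(α k *
      (Metric.ball (x k) (r k)).indicator (smearedDensity (x k) (r k)) y) := by
    intro y hy
    rw [hu, laplacian_finset_sum (F := fun l y => α l * U l y) _
      fun l _ => contDiffAt_const.mul (hUd l y hy)]
    refine Finset.sum_congr rfl fun l _ => ?_
    have h1 := laplacian_smul (α l) (hUd l y hy)
    have h2 : (α l • U l) = fun y => α l * U l y := rfl
    rw [h2] at h1
    rw [h1, hU, smearedPotential_laplacian ho hg (hr l) (hball l) hy, smul_eq_mul, mul_neg]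
  have hdens : ∀ k, IntegrableOn
      ((Metric.ball (x k) (r k)).indicator (smearedDensity (x k) (r k))) Ω := fun k => by
    refine Integrable.integrableOn ?_
    rw [integrable_indicator_iff measurableSet_ball]
    exact ((smearedDensity_continuous _ _).continuousOn.integrableOn_compact
      (isCompact_closedBall (x k) (r k))).mono_set Metric.ball_subset_closedBall
  have hlapint : IntegrableOn (Laplacian.laplacian u) Ω := by
    have h1 : IntegrableOn (fun y => ∑ k, -(α k *
      (Metric.ball (x k) (r k)).indicator (smearedDensity (x k) (r k)) y)) Ω :=
      integrable_finsetSum _ fun k _ => ((hdens k).const_mul (α k)).neg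
    exact h1.congr_fun (fun y hy => (hlap y hy).symm) ho.measurableSet
  -- Since `-Δu` is the total smeared charge density, this says that the total field energy,
  -- self-energies included, is nonnegative.
  have hpos := setIntegral_mul_laplacian_nonpos ho hb huC hucont hu0 hlapint
  set J : Fin n → Fin n → ℝ := fun k l =>
    ∫ y in Metric.ball (x k) (r k), smearedDensity (x k) (r k) y * U l y with hJ
  have hJint : ∀ k l, IntegrableOn (fun y => smearedDensity (x k) (r k) y * U l y)
      (Metric.ball (x k) (r k)) := fun k l =>
    integrableOn_smearedDensity_mul_smearedPotential hg (hball k) (hr l) (hball l)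
  have hind : ∀ k l y, (Metric.ball (x k) (r k)).indicator (smearedDensity (x k) (r k)) y * U l y
      = (Metric.ball (x k) (r k)).indicator (fun y => smearedDensity (x k) (r k) y * U l y) y :=
    fun k l y => by
      by_cases hy : y ∈ Metric.ball (x k) (r k) <;> simp [hy]
  have hexp : ∫ y in Ω, u y * Laplacian.laplacian u y = -∑ k, ∑ l, α k * α l * J k l := by
    have h1 : ∀ y ∈ Ω, u y * Laplacian.laplacian u y = ∑ k, ∑ l, (-(α k * α l)) *
        (Metric.ball (x k) (r k)).indicator
          (fun y => smearedDensity (x k) (r k) y * U l y) y := by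
      intro y hy
      rw [hlap y hy, hu, mul_comm, Finset.sum_mul]
      refine Finset.sum_congr rfl fun k _ => ?_
      rw [Finset.mul_sum]
      refine Finset.sum_congr rfl fun l _ => ?_
      rw [← hind]
      ring
    have h2 : ∀ k l, Integrable (fun y => (-(α k * α l)) *
        (Metric.ball (x k) (r k)).indicator
          (fun y => smearedDensity (x k) (r k) y * U l y) y) (volume.restrict Ω) := fun k l =>
      (((integrable_indicator_iff measurableSet_ball).2 (hJint k l)).integrableOn).const_mul _
    rw [setIntegral_congr_fun ho.measurableSet h1,
      integral_finsetSum _ fun k _ => integrable_finsetSum _ fun l _ => h2 k l,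
      ← Finset.sum_neg_distrib]
    refine Finset.sum_congr rfl fun k _ => ?_
    rw [integral_finsetSum _ fun l _ => h2 k l, ← Finset.sum_neg_distrib]
    refine Finset.sum_congr rfl fun l _ => ?_
    rw [integral_const_mul, setIntegral_indicator measurableSet_ball, Set.inter_eq_right.2
      (Metric.ball_subset_closedBall.trans (hball k))]
    simp only [hJ]
    ring
  rw [hexp] at hpos
  have hmem : ∀ k, x k ∈ Ω := fun k => center_mem_of_closedBall_subset (hr k) (hball k)
  have hJoff : ∀ k l, k ≠ l → J k l = greenFunction Ω (x k) (x l) := fun k l hkl =>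
    integral_smearedDensity_mul_smearedPotential ho hg (hr k) (hball k) hb (hr l) (hball l)
      (hsep k l hkl)
  -- The double sum meets each unordered pair twice, `coulombEnergy` once.
  have hsplit : ∑ k, ∑ l, α k * α l * J k l =
      ∑ k, α k ^ 2 * J k k + 2 * coulombEnergy Ω α x := by
    have h1 : ∀ k, ∑ l, α k * α l * J k l =
        α k ^ 2 * J k k + ∑ l ∈ {k}ᶜ, α l * α k * greenFunction Ω (x l) (x k) := by
      intro k
      rw [← Finset.sum_add_sum_compl {k}, Finset.sum_singleton, sq]
      congr 1
      refine Finset.sum_congr rfl fun l hl => ?_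
      have hlk : l ≠ k := by simpa using hl
      rw [hJoff k l hlk.symm, greenFunction_comm ho hb hg (hmem l) (hmem k)]
      ring
    rw [Finset.sum_congr rfl fun k _ => h1 k, Finset.sum_add_distrib, coulombEnergy,
      ← Finset.sum_sum_Ioi_add_eq_sum_sum_off_diag
        (fun l k => α l * α k * greenFunction Ω (x l) (x k)), Finset.mul_sum]
    congr 1
    refine Finset.sum_congr rfl fun k _ => ?_
    rw [Finset.mul_sum]
    refine Finset.sum_congr rfl fun l _ => ?_
    rw [greenFunction_comm ho hb hg (hmem l) (hmem k)]
    ring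
  rw [hsplit] at hpos
  have hself : ∑ k, α k ^ 2 * J k k ≤ ∑ k, α k ^ 2 *
      (g (x k) (x k) - 1 / (2 * Real.pi) * Real.log (r k) + 3 / (8 * Real.pi)) :=
    Finset.sum_le_sum fun k _ => mul_le_mul_of_nonneg_left
      (integral_smearedDensity_mul_smearedPotential_self_le hg (hr k) (hball k))
      (sq_nonneg _)
  linarith

/-! ### Nearest-neighbour distances and the effect of adding a point. -/

/-- At most `25` points of the plane have a given further point as nearest neighbour. -/
theorem card_le_of_nearest {ι : Type*} (A : Finset ι) (y : ι → ℂ) (z : ℂ)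
    (h0 : ∀ k ∈ A, y k ≠ z)
    (hA : ∀ k ∈ A, ∀ j ∈ A, j ≠ k → ‖y k - z‖ ≤ ‖y k - y j‖) : A.card ≤ 25 := by
  -- The cell of the doubled unit direction from `z` in the integer grid, one of `5 * 5`. Two of the
  -- points are seen from `z` at an angle of at least 60 degrees, so their doubled directions have
  -- squared distance at least 4, whereas within one cell it is below 2.
  set φ : ι → ℤ × ℤ := fun k =>
    (⌊2 * ((y k - z).re / ‖y k - z‖)⌋, ⌊2 * ((y k - z).im / ‖y k - z‖)⌋) with hφ
  have hpos : ∀ k ∈ A, 0 < ‖y k - z‖ := fun k hk => norm_pos_iff.2 (sub_ne_zero.2 (h0 k hk))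
  have hfl : ∀ t s : ℝ, 0 < s → |t| ≤ s → ⌊2 * (t / s)⌋ ∈ Finset.Icc (-2 : ℤ) 2 := by
    intro t s hs ht
    have h1 : |t / s| ≤ 1 := by rw [abs_div, abs_of_pos hs]; exact (div_le_one hs).2 ht
    rw [abs_le] at h1
    rw [Finset.mem_Icc]
    constructor
    · rw [Int.le_floor]; push_cast; linarith
    · have := Int.floor_le (2 * (t / s))
      have h2 : ((⌊2 * (t / s)⌋ : ℤ) : ℝ) < 3 := by linarith
      have h3 : ⌊2 * (t / s)⌋ < 3 := by exact_mod_cast h2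
      omega
  have hmaps : ∀ k ∈ A, φ k ∈ Finset.Icc (-2 : ℤ) 2 ×ˢ Finset.Icc (-2 : ℤ) 2 := fun k hk =>
    Finset.mem_product.2 ⟨hfl _ _ (hpos k hk) (Complex.abs_re_le_norm _),
      hfl _ _ (hpos k hk) (Complex.abs_im_le_norm _)⟩
  refine (Finset.card_le_card_of_injOn φ hmaps ?_).trans (by simp)
  intro j hj k hk hjk
  by_contra hne
  have hj' := hpos j hj
  have hk' := hpos k hk
  have h1 := hA k hk j hj hne
  have h2 := hA j hj k hk (Ne.symm hne)
  rw [norm_sub_rev] at h2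
  set s := ‖y j - z‖ with hs
  set t := ‖y k - z‖ with ht
  set a := (y j - z).re with ha
  set b := (y j - z).im with hb
  set c := (y k - z).re with hc
  set d := (y k - z).im with hd
  have hs2 : s ^ 2 = a ^ 2 + b ^ 2 := by
    rw [hs, ← Complex.normSq_eq_norm_sq, Complex.normSq_apply]; ring
  have ht2 : t ^ 2 = c ^ 2 + d ^ 2 := by
    rw [ht, ← Complex.normSq_eq_norm_sq, Complex.normSq_apply]; ring
  have hst : ‖y k - y j‖ ^ 2 = (c - a) ^ 2 + (d - b) ^ 2 := by
    rw [← Complex.normSq_eq_norm_sq, Complex.normSq_apply]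
    simp only [ha, hb, hc, hd, Complex.sub_re, Complex.sub_im]
    ring
  have h1' : t ^ 2 ≤ ‖y k - y j‖ ^ 2 := by gcongr
  have h2' : s ^ 2 ≤ ‖y k - y j‖ ^ 2 := by
    rw [norm_sub_rev] at h2; gcongr; rwa [norm_sub_rev]
  have hin : 2 * (a * c + b * d) ≤ s * t := by
    rcases le_total s t with h | h
    · nlinarith
    · nlinarith
  simp only [hφ, Prod.mk.injEq] at hjk
  have e1 := Int.abs_sub_lt_one_of_floor_eq_floor hjk.1
  have e2 := Int.abs_sub_lt_one_of_floor_eq_floor hjk.2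
  have q1 : (2 * (a / s) - 2 * (c / t)) ^ 2 < 1 := by rwa [sq_lt_one_iff_abs_lt_one]
  have q2 : (2 * (b / s) - 2 * (d / t)) ^ 2 < 1 := by rwa [sq_lt_one_iff_abs_lt_one]
  have q3 : (2 * (a / s) - 2 * (c / t)) ^ 2 + (2 * (b / s) - 2 * (d / t)) ^ 2 =
      8 - 8 * ((a * c + b * d) / (s * t)) := by
    have e3 : (a / s) ^ 2 + (b / s) ^ 2 = 1 := by
      rw [div_pow, div_pow, ← add_div, ← hs2]; field_simp
    have e4 : (c / t) ^ 2 + (d / t) ^ 2 = 1 := by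
      rw [div_pow, div_pow, ← add_div, ← ht2]; field_simp
    have e5 : (a * c + b * d) / (s * t) = (a / s) * (c / t) + (b / s) * (d / t) := by
      field_simp
    rw [e5]
    linear_combination 4 * e3 + 4 * e4
  have q4 : (a * c + b * d) / (s * t) ≤ 1 / 2 := by
    rw [div_le_iff₀ (by positivity)]; linarith
  linarith

/-- The distance of `x k` to the other points, capped by `δ`. -/
noncomputable def nearestDist (δ : ℝ) {n : ℕ} (x : Fin n → ℂ) (k : Fin n) : ℝ :=
  ⨅ l, if l = k then δ else ‖x k - x l‖

section NearestDist

variable {δ : ℝ} {n : ℕ} {x : Fin n → ℂ} {k : Fin n}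

theorem nearestDist_le_cap : nearestDist δ x k ≤ δ :=
  (ciInf_le (Set.finite_range _).bddBelow k).trans (by simp)

theorem nearestDist_le {l : Fin n} (h : l ≠ k) : nearestDist δ x k ≤ ‖x k - x l‖ :=
  (ciInf_le (Set.finite_range _).bddBelow l).trans (by simp [h])

theorem le_nearestDist {c : ℝ} (h : c ≤ δ) (h' : ∀ l, l ≠ k → c ≤ ‖x k - x l‖) :
    c ≤ nearestDist δ x k := by
  have : Nonempty (Fin n) := ⟨k⟩
  refine le_ciInf fun l => ?_
  split_ifs with hl
  · exact h
  · exact h' l hl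

theorem nearestDist_eq_or :
    nearestDist δ x k = δ ∨ ∃ l, l ≠ k ∧ nearestDist δ x k = ‖x k - x l‖ := by
  have : Nonempty (Fin n) := ⟨k⟩
  obtain ⟨l, hl⟩ := exists_eq_ciInf_of_finite (f := fun l => if l = k then δ else ‖x k - x l‖)
  by_cases h : l = k
  · left; rw [nearestDist, ← hl, if_pos h]
  · right; exact ⟨l, h, by rw [nearestDist, ← hl, if_neg h]⟩

theorem nearestDist_pos (hδ : 0 < δ) (hx : Function.Injective x) : 0 < nearestDist δ x k := by
  rcases nearestDist_eq_or (δ := δ) (x := x) (k := k) with h | ⟨l, hl, h⟩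
  · rwa [h]
  · rw [h, norm_pos_iff, sub_ne_zero]
    exact fun h => hl (hx h.symm)

/-- Configurations grow by appending a last point, and an old nearest distance can then only drop to
the distance from the new point. -/
theorem nearestDist_castSucc {x : Fin (n + 1) → ℂ} {k : Fin n} :
    nearestDist δ x k.castSucc =
      min (nearestDist δ (fun j => x j.castSucc) k) ‖x k.castSucc - x (Fin.last n)‖ := by
  apply le_antisymm
  · refine le_min (le_nearestDist nearestDist_le_cap fun l hl => ?_)
      (nearestDist_le (Fin.castSucc_lt_last k).ne')
    exact nearestDist_le (fun h => hl (Fin.castSucc_injective n h))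
  · refine le_nearestDist ((min_le_left _ _).trans nearestDist_le_cap) fun l => ?_
    induction l using Fin.lastCases with
    | last => exact fun _ => min_le_right _ _
    | cast l =>
      intro hl
      exact (min_le_left _ _).trans (nearestDist_le fun h => hl (by rw [h]))

end NearestDist

/-- The product of the nearest neighbour distances to the power `-a`. -/
noncomputable def nearestWeight (a δ : ℝ) {n : ℕ} (x : Fin n → ℂ) : ℝ :=
  ∏ k, nearestDist δ x k ^ (-a)

/-- The factor by which `nearestWeight` grows when a point is added. -/
noncomputable def nearestKernel (a δ ε : ℝ) {n : ℕ} (x : Fin n → ℂ) (z : ℂ) : ℝ :=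
  (δ ^ (-a) + ε ^ (-a)) + ((∑ k, (Metric.ball (x k) ε).indicator (fun z => ‖z - x k‖ ^ (-a)) z) +
    ∑ k, (Metric.ball (x k) (nearestDist δ x k)).indicator
      (fun z => nearestDist δ x k ^ a * ‖z - x k‖ ^ (-(2 * a))) z)

theorem nearestWeight_nonneg {a δ : ℝ} (hδ : 0 < δ) {n : ℕ} {x : Fin n → ℂ} :
    0 ≤ nearestWeight a δ x :=
  Finset.prod_nonneg fun _ _ => Real.rpow_nonneg
    (le_nearestDist hδ.le fun _ _ => norm_nonneg _) _

/-- Let `k₀` be the old point closest to `z`. Every other old point that `z` comes nearest to has `r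
k ≤ 2 * d k`, through `k₀`, and contributes a factor at most 2. If `k₀` is affected as well, its
factor and the weight of `z` form a term of the second sum in the kernel. If not, only the weight of
`z` is left: it comes from the cap `δ`, from a distance at least `ε`, or from a term of the first
sum. -/
theorem nearestWeight_succ_le {a δ ε : ℝ} (ha : 0 ≤ a) (ha1 : a ≤ 1) (hδ : 0 < δ) (hε : 0 < ε)
    {n : ℕ} [NeZero n] {x : Fin (n + 1) → ℂ} (hx : Function.Injective x) :
    nearestWeight a δ x ≤ 2 ^ 25 * nearestWeight a δ (fun k => x k.castSucc) *
      nearestKernel a δ ε (fun k => x k.castSucc) (x (Fin.last n)) := by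
  classical
  set z := x (Fin.last n) with hz
  set y : Fin n → ℂ := fun k => x k.castSucc with hy
  have hyinj : Function.Injective y := hx.comp (Fin.castSucc_injective n)
  set d : Fin n → ℝ := fun k => ‖y k - z‖ with hd
  have hdpos : ∀ k, 0 < d k := fun k => norm_pos_iff.2 (sub_ne_zero.2 fun h =>
    (Fin.castSucc_lt_last k).ne (hx h))
  set r : Fin n → ℝ := nearestDist δ y with hr
  have hrpos : ∀ k, 0 < r k := fun k => nearestDist_pos hδ hyinj
  set A : Finset (Fin n) := Finset.univ.filter fun k => d k < r k with hA
  have hmemA : ∀ {k}, k ∈ A ↔ d k < r k := by simp [hA]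
  have hcard : A.card ≤ 25 := by
    refine card_le_of_nearest A y z (fun k _ => sub_ne_zero.1 (norm_pos_iff.1 (hdpos k))) ?_
    intro k hk j _ hjk
    exact (hmemA.1 hk).le.trans (nearestDist_le hjk)
  obtain ⟨k₀, -, hk₀⟩ := Finset.exists_min_image (Finset.univ : Finset (Fin n)) d
    ⟨0, Finset.mem_univ _⟩
  have hratio : ∀ k ∈ A, k ≠ k₀ → (r k / d k) ^ a ≤ 2 := by
    intro k _ hkk
    have h1 : r k ≤ 2 * d k := by
      have h2 : r k ≤ ‖y k - y k₀‖ := nearestDist_le hkk.symm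
      have h3 := norm_sub_le_norm_sub_add_norm_sub (y k) z (y k₀)
      rw [norm_sub_rev z] at h3
      have h4 : d k₀ ≤ d k := hk₀ k (Finset.mem_univ k)
      simp only [hd] at h4 ⊢
      linarith
    have h2 : r k / d k ≤ 2 := (div_le_iff₀ (hdpos k)).2 h1
    have h3 : 0 ≤ r k / d k := (div_pos (hrpos k) (hdpos k)).le
    calc (r k / d k) ^ a ≤ 2 ^ a := Real.rpow_le_rpow h3 h2 ha
      _ ≤ 2 ^ (1 : ℝ) := Real.rpow_le_rpow_of_exponent_le (by norm_num) ha1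
      _ = 2 := Real.rpow_one 2
  have hprod : ∀ B ⊆ A, (∀ k ∈ B, k ≠ k₀) → ∏ k ∈ B, (r k / d k) ^ a ≤ 2 ^ 25 := by
    intro B hB hBk
    calc ∏ k ∈ B, (r k / d k) ^ a ≤ ∏ _k ∈ B, (2 : ℝ) :=
          Finset.prod_le_prod (fun k _ => Real.rpow_nonneg
            (div_pos (hrpos k) (hdpos k)).le _) fun k hk => hratio k (hB hk) (hBk k hk)
      _ = 2 ^ B.card := by simp
      _ ≤ 2 ^ 25 := pow_le_pow_right₀ (by norm_num) ((Finset.card_le_card hB).trans hcard)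
  have hsplit : nearestWeight a δ x = nearestWeight a δ y * (∏ k ∈ A, (r k / d k) ^ a) *
      nearestDist δ x (Fin.last n) ^ (-a) := by
    rw [nearestWeight, Fin.prod_univ_castSucc, nearestWeight]
    congr 1
    have h1 : ∏ k ∈ A, (r k / d k) ^ a = ∏ k, if k ∈ A then (r k / d k) ^ a else 1 := by
      rw [Finset.prod_ite_mem, Finset.univ_inter]
    rw [h1, ← Finset.prod_mul_distrib]
    refine Finset.prod_congr rfl fun k _ => ?_
    rw [nearestDist_castSucc]
    change min (r k) (d k) ^ (-a) = r k ^ (-a) * _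
    split_ifs with hk
    · rw [min_eq_right (hmemA.1 hk).le, Real.div_rpow (hrpos k).le (hdpos k).le,
        Real.rpow_neg (hrpos k).le, Real.rpow_neg (hdpos k).le]
      have := Real.rpow_pos_of_pos (hrpos k) a
      field_simp
    · rw [min_eq_left (not_lt.1 fun h => hk (hmemA.2 h)), mul_one]
  have hw := nearestWeight_nonneg (a := a) hδ (x := y)
  set S₁ := ∑ k, (Metric.ball (y k) ε).indicator (fun z => ‖z - y k‖ ^ (-a)) z with hS₁
  set S₂ := ∑ k, (Metric.ball (y k) (nearestDist δ y k)).indicator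
      (fun z => nearestDist δ y k ^ a * ‖z - y k‖ ^ (-(2 * a))) z with hS₂
  have ht₁ : ∀ k ∈ Finset.univ,
      0 ≤ (Metric.ball (y k) ε).indicator (fun z => ‖z - y k‖ ^ (-a)) z := fun k _ =>
    Set.indicator_nonneg (fun _ _ => Real.rpow_nonneg (norm_nonneg _) _) _
  have ht₂ : ∀ k ∈ Finset.univ, 0 ≤ (Metric.ball (y k) (nearestDist δ y k)).indicator
      (fun z => nearestDist δ y k ^ a * ‖z - y k‖ ^ (-(2 * a))) z := fun k _ =>
    Set.indicator_nonneg (fun _ _ => mul_nonneg (Real.rpow_nonneg (hrpos k).le _)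
      (Real.rpow_nonneg (norm_nonneg _) _)) _
  have hS₁nn : 0 ≤ S₁ := Finset.sum_nonneg ht₁
  have hS₂nn : 0 ≤ S₂ := Finset.sum_nonneg ht₂
  have hδa : 0 ≤ δ ^ (-a) := Real.rpow_nonneg hδ.le _
  have hεa : 0 ≤ ε ^ (-a) := Real.rpow_nonneg hε.le _
  have hker : nearestKernel a δ ε y z = (δ ^ (-a) + ε ^ (-a)) + (S₁ + S₂) := rfl
  have hlast : 0 < nearestDist δ x (Fin.last n) := nearestDist_pos hδ hx
  have main : (∏ k ∈ A, (r k / d k) ^ a) * nearestDist δ x (Fin.last n) ^ (-a) ≤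
      2 ^ 25 * nearestKernel a δ ε y z := by
    by_cases hk₀A : k₀ ∈ A
    · have hdr := hmemA.1 hk₀A
      rw [← Finset.mul_prod_erase A _ hk₀A]
      have h1 := hprod (A.erase k₀) (Finset.erase_subset _ _) fun k hk => Finset.ne_of_mem_erase hk
      have h2 : d k₀ ≤ nearestDist δ x (Fin.last n) := by
        refine le_nearestDist (hdr.le.trans nearestDist_le_cap) fun l => ?_
        induction l using Fin.lastCases with
        | last => exact fun h => (h rfl).elim
        | cast l =>
          intro _
          rw [norm_sub_rev]
          exact hk₀ l (Finset.mem_univ l)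
      have h3 : nearestDist δ x (Fin.last n) ^ (-a) ≤ d k₀ ^ (-a) :=
        Real.rpow_le_rpow_of_nonpos (hdpos k₀) h2 (by linarith)
      -- The exponent `2 * a` arises here: the distance between `z` and `k₀` counts once for each of
      -- the two points.
      have h4 : (r k₀ / d k₀) ^ a * d k₀ ^ (-a) ≤ S₂ := by
        refine le_trans (le_of_eq ?_) (Finset.single_le_sum ht₂ (Finset.mem_univ k₀))
        rw [Set.indicator_of_mem]
        · rw [norm_sub_rev z]
          change _ = r k₀ ^ a * d k₀ ^ (-(2 * a))
          rw [Real.div_rpow (hrpos k₀).le (hdpos k₀).le, div_eq_mul_inv, mul_assoc,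
            ← Real.rpow_neg (hdpos k₀).le, ← Real.rpow_add (hdpos k₀)]
          congr 2
          ring
        · rw [Metric.mem_ball, dist_eq_norm, norm_sub_rev]
          exact hdr
      have hq : 0 ≤ (r k₀ / d k₀) ^ a := Real.rpow_nonneg (div_pos (hrpos k₀) (hdpos k₀)).le _
      calc (r k₀ / d k₀) ^ a * (∏ k ∈ A.erase k₀, (r k / d k) ^ a) *
            nearestDist δ x (Fin.last n) ^ (-a)
          ≤ (r k₀ / d k₀) ^ a * 2 ^ 25 * d k₀ ^ (-a) :=
            mul_le_mul (mul_le_mul_of_nonneg_left h1 hq) h3 (Real.rpow_nonneg hlast.le _)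
              (by positivity)
        _ = 2 ^ 25 * ((r k₀ / d k₀) ^ a * d k₀ ^ (-a)) := by ring
        _ ≤ 2 ^ 25 * nearestKernel a δ ε y z := by
            rw [hker]
            refine mul_le_mul_of_nonneg_left ?_ (by norm_num)
            linarith
    · have h1 := hprod A subset_rfl fun _ hk h => hk₀A (h ▸ hk)
      have h2 : nearestDist δ x (Fin.last n) ^ (-a) ≤ (δ ^ (-a) + ε ^ (-a)) + S₁ := by
        rcases nearestDist_eq_or (δ := δ) (x := x) (k := Fin.last n) with h | ⟨l, hl, h⟩
        · rw [h]; linarith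
        · rw [h]
          induction l using Fin.lastCases with
          | last => exact (hl rfl).elim
          | cast l =>
            by_cases hlε : ‖x (Fin.last n) - x l.castSucc‖ < ε
            · have h3 : ‖x (Fin.last n) - x l.castSucc‖ ^ (-a) ≤ S₁ := by
                refine le_trans (le_of_eq ?_) (Finset.single_le_sum ht₁ (Finset.mem_univ l))
                rw [Set.indicator_of_mem]
                rw [Metric.mem_ball, dist_eq_norm]
                exact hlε
              linarith
            · have := Real.rpow_le_rpow_of_nonpos hε (not_lt.1 hlε) (by linarith : -a ≤ 0)
              linarith
      calc (∏ k ∈ A, (r k / d k) ^ a) * nearestDist δ x (Fin.last n) ^ (-a)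
          ≤ 2 ^ 25 * ((δ ^ (-a) + ε ^ (-a)) + S₁) :=
            mul_le_mul h1 h2 (Real.rpow_nonneg hlast.le _) (by norm_num)
        _ ≤ 2 ^ 25 * nearestKernel a δ ε y z := by
            rw [hker]
            refine mul_le_mul_of_nonneg_left ?_ (by norm_num)
            linarith
  rw [hsplit]
  calc _ = nearestWeight a δ y * ((∏ k ∈ A, (r k / d k) ^ a) *
        nearestDist δ x (Fin.last n) ^ (-a)) := by ring
    _ ≤ nearestWeight a δ y * (2 ^ 25 * nearestKernel a δ ε y z) :=
        mul_le_mul_of_nonneg_left main hw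
    _ = _ := by ring

/-! ### Integration of the weight, one point at a time. -/

theorem lintegral_ball_rpow (c : ℂ) {t b : ℝ} (ht : 0 < t) (hb : b < 2) :
    ∫⁻ z in Metric.ball c t, ENNReal.ofReal (‖z - c‖ ^ (-b)) =
      ENNReal.ofReal (2 * Real.pi / (2 - b) * t ^ (2 - b)) := by
  have hpi := Real.pi_pos
  rw [← lintegral_indicator measurableSet_ball, ← lintegral_add_left_eq_self _ c,
    ← Complex.lintegral_comp_polarCoord_symm, polarCoord_target]
  have hpt : ∀ p ∈ Set.Ioi (0 : ℝ) ×ˢ Set.Ioo (-Real.pi) Real.pi,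
      ENNReal.ofReal p.1 • (Metric.ball c t).indicator
        (fun z => ENNReal.ofReal (‖z - c‖ ^ (-b))) (c + Complex.polarCoord.symm p) =
      (Set.Iio t).indicator (fun s => ENNReal.ofReal (s ^ (1 - b))) p.1 * 1 := by
    rintro p ⟨hp, -⟩
    have hp' : 0 < p.1 := hp
    have hn : ‖c + Complex.polarCoord.symm p - c‖ = p.1 := by
      rw [add_sub_cancel_left, Complex.norm_polarCoord_symm, abs_of_pos hp']
    by_cases h : p.1 < t
    · rw [Set.indicator_of_mem, Set.indicator_of_mem (Set.mem_Iio.2 h), hn, smul_eq_mul, mul_one,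
        ← ENNReal.ofReal_mul hp'.le, sub_eq_add_neg, Real.rpow_add hp', Real.rpow_one]
      rw [Metric.mem_ball, dist_eq_norm, hn]; exact h
    · rw [Set.indicator_of_notMem, Set.indicator_of_notMem (by simpa using h), smul_zero, zero_mul]
      rw [Metric.mem_ball, dist_eq_norm, hn]; exact h
  have hmeas : Measurable ((Set.Iio t).indicator (fun s => ENNReal.ofReal (s ^ (1 - b)))) :=
    Measurable.indicator (by fun_prop) measurableSet_Iio
  rw [setLIntegral_congr_fun (measurableSet_Ioi.prod measurableSet_Ioo) hpt,
    Measure.volume_eq_prod, ← Measure.prod_restrict,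
    lintegral_prod_mul hmeas.aemeasurable aemeasurable_const]
  have h1 : ∫⁻ _θ in Set.Ioo (-Real.pi) Real.pi, 1 = ENNReal.ofReal (2 * Real.pi) := by
    rw [setLIntegral_one, Real.volume_Ioo]
    congr 1
    ring
  have h2 : ∫⁻ s in Set.Ioi (0 : ℝ), (Set.Iio t).indicator
      (fun s => ENNReal.ofReal (s ^ (1 - b))) s = ENNReal.ofReal (t ^ (2 - b) / (2 - b)) := by
    have hint : IntervalIntegrable (fun s : ℝ => s ^ (1 - b)) volume 0 t :=
      intervalIntegral.intervalIntegrable_rpow' (by linarith)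
    rw [lintegral_indicator measurableSet_Iio, Measure.restrict_restrict measurableSet_Iio,
      Set.inter_comm, Set.Ioi_inter_Iio, restrict_Ioo_eq_restrict_Ioc,
      ← ofReal_integral_eq_lintegral_ofReal hint.1, ← intervalIntegral.integral_of_le ht.le,
      integral_rpow (Or.inl (by linarith))]
    · rw [show 1 - b + 1 = 2 - b by ring, Real.zero_rpow (by linarith), sub_zero]
    · filter_upwards [ae_restrict_mem measurableSet_Ioc] with s hs
      exact Real.rpow_nonneg hs.1.le _
  rw [h1, h2, ← ENNReal.ofReal_mul (div_nonneg (Real.rpow_nonneg ht.le _) (by linarith))]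
  congr 1
  ring

/-- A packing bound. -/
theorem sum_sq_nearestDist_le {δ D : ℝ} (hδ : 0 < δ) (hδ1 : δ ≤ 1) {n : ℕ} {x : Fin n → ℂ}
    (hD : 0 ≤ D) (hx : ∀ k, ‖x k‖ < D) :
    ∑ k, nearestDist δ x k ^ 2 ≤ 4 * (D + 1) ^ 2 := by
  set r : Fin n → ℝ := nearestDist δ x with hr
  have hr0 : ∀ k, 0 ≤ r k := fun k => le_nearestDist hδ.le fun _ _ => norm_nonneg _
  -- Discs of half the nearest distance are disjoint and lie in a disc of radius `D + 1`; comparing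
  -- areas gives the bound.
  have hdisj : Pairwise (Function.onFun Disjoint fun k => Metric.ball (x k) (r k / 2)) := by
    intro k l hkl
    apply Metric.ball_disjoint_ball
    have h1 : r k ≤ ‖x k - x l‖ := nearestDist_le hkl.symm
    have h2 : r l ≤ ‖x l - x k‖ := nearestDist_le hkl
    rw [norm_sub_rev] at h2
    rw [dist_eq_norm]
    linarith
  have hsub : (⋃ k, Metric.ball (x k) (r k / 2)) ⊆ Metric.ball 0 (D + 1) := by
    refine Set.iUnion_subset fun k z hz => ?_
    have h1 : r k ≤ δ := nearestDist_le_cap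
    rw [Metric.mem_ball] at hz ⊢
    have h2 := dist_triangle z (x k) 0
    rw [dist_zero_right (x k)] at h2
    have := hx k
    linarith
  have hvol := measure_mono (μ := volume) hsub
  rw [measure_iUnion hdisj fun k => measurableSet_ball, tsum_fintype, Complex.volume_ball] at hvol
  simp only [Complex.volume_ball] at hvol
  rw [← Finset.sum_mul] at hvol
  have hpi : (NNReal.pi : ENNReal) ≠ 0 := by
    simp [NNReal.pi_ne_zero]
  rw [ENNReal.mul_le_mul_iff_left hpi ENNReal.coe_ne_top,
    ← ENNReal.ofReal_pow (by linarith : 0 ≤ D + 1)] at hvol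
  have h3 : ∑ k, ENNReal.ofReal (r k / 2) ^ 2 = ENNReal.ofReal (∑ k, (r k / 2) ^ 2) := by
    rw [ENNReal.ofReal_sum_of_nonneg fun k _ => sq_nonneg _]
    refine Finset.sum_congr rfl fun k _ => ?_
    rw [ENNReal.ofReal_pow (by linarith [hr0 k])]
  rw [h3, ENNReal.ofReal_le_ofReal_iff (by positivity)] at hvol
  have h4 : ∑ k, (r k / 2) ^ 2 = (∑ k, r k ^ 2) / 4 := by
    rw [Finset.sum_div]
    refine Finset.sum_congr rfl fun k _ => ?_
    ring
  rw [h4] at hvol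
  linarith

/-- The cut `ε = n ^ (-1/2)` balances the terms: `ε ^ (-a)` and `n * ε ^ (2 - a)` both equal `n ^ (a
/ 2)`. The terms with exponent `2 * a` are integrable because `a < 1`, and their integrals are
multiples of `r k ^ (2 - a)`, whose sum is controlled by packing. -/
theorem lintegral_nearestKernel_le {a δ D : ℝ} (ha : 0 ≤ a) (ha1 : a < 1) (hδ : 0 < δ)
    (hδ1 : δ ≤ 1) (hD : 0 ≤ D) {n : ℕ} (hn : 0 < n) {x : Fin n → ℂ} (hinj : Function.Injective x)
    (hx : ∀ k, ‖x k‖ < D) {S : Set ℂ} (hS : S ⊆ Metric.ball 0 D) :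
    ∫⁻ z in S, ENNReal.ofReal (nearestKernel a δ ((n : ℝ) ^ (-(1 / 2) : ℝ)) x z) ≤
      ENNReal.ofReal (((δ ^ (-a) + 1) * (Real.pi * D ^ 2) + 2 * Real.pi +
        Real.pi / (1 - a) * (4 * (D + 1) ^ 2 + 1)) * (n : ℝ) ^ (a / 2)) := by
  have hpi := Real.pi_pos
  have hn1 : (1 : ℝ) ≤ n := by exact_mod_cast hn
  have hn0 : (0 : ℝ) < n := by linarith
  set N : ℝ := (n : ℝ) ^ (a / 2) with hN
  have hN1 : 1 ≤ N := Real.one_le_rpow hn1 (by linarith)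
  set ε : ℝ := (n : ℝ) ^ (-(1 / 2) : ℝ) with hε
  have hε0 : 0 < ε := Real.rpow_pos_of_pos hn0 _
  have hεa : ε ^ (-a) = N := by
    rw [hε, hN, ← Real.rpow_mul hn0.le]; congr 1; ring
  have hε2 : ε ^ (2 - a) = N / n := by
    rw [hε, hN, ← Real.rpow_mul hn0.le, ← Real.rpow_sub_one hn0.ne']; congr 1; ring
  set r : Fin n → ℝ := nearestDist δ x with hr
  have hr0 : ∀ k, 0 < r k := fun k => nearestDist_pos hδ hinj
  have hδa : 0 ≤ δ ^ (-a) := Real.rpow_nonneg hδ.le _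
  have hm₁ : ∀ k, Measurable fun z => ENNReal.ofReal
      ((Metric.ball (x k) ε).indicator (fun z => ‖z - x k‖ ^ (-a)) z) := fun k =>
    (Measurable.indicator (by fun_prop) measurableSet_ball).ennreal_ofReal
  have hm₂ : ∀ k, Measurable fun z => ENNReal.ofReal ((Metric.ball (x k) (r k)).indicator
      (fun z => r k ^ a * ‖z - x k‖ ^ (-(2 * a))) z) := fun k =>
    (Measurable.indicator (by fun_prop) measurableSet_ball).ennreal_ofReal
  have hpt : ∀ z, ENNReal.ofReal (nearestKernel a δ ε x z) =
      ENNReal.ofReal (δ ^ (-a) + N) + ((∑ k, ENNReal.ofReal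
      ((Metric.ball (x k) ε).indicator (fun z => ‖z - x k‖ ^ (-a)) z)) +
      ∑ k, ENNReal.ofReal ((Metric.ball (x k) (r k)).indicator
        (fun z => r k ^ a * ‖z - x k‖ ^ (-(2 * a))) z)) := by
    intro z
    have ht₁ : ∀ k ∈ Finset.univ,
        0 ≤ (Metric.ball (x k) ε).indicator (fun z => ‖z - x k‖ ^ (-a)) z := fun k _ =>
      Set.indicator_nonneg (fun _ _ => Real.rpow_nonneg (norm_nonneg _) _) _
    have ht₂ : ∀ k ∈ Finset.univ, 0 ≤ (Metric.ball (x k) (r k)).indicator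
        (fun z => r k ^ a * ‖z - x k‖ ^ (-(2 * a))) z := fun k _ =>
      Set.indicator_nonneg (fun _ _ => mul_nonneg (Real.rpow_nonneg (hr0 k).le _)
        (Real.rpow_nonneg (norm_nonneg _) _)) _
    rw [← ENNReal.ofReal_sum_of_nonneg ht₁, ← ENNReal.ofReal_sum_of_nonneg ht₂,
      ← ENNReal.ofReal_add (Finset.sum_nonneg ht₁) (Finset.sum_nonneg ht₂),
      ← ENNReal.ofReal_add (by positivity)
        (add_nonneg (Finset.sum_nonneg ht₁) (Finset.sum_nonneg ht₂)), nearestKernel, hεa]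
  have hind₁ : ∀ k, ∫⁻ z in S, ENNReal.ofReal
      ((Metric.ball (x k) ε).indicator (fun z => ‖z - x k‖ ^ (-a)) z) ≤
      ENNReal.ofReal (2 * Real.pi * (N / n)) := by
    intro k
    have e : (fun z => ENNReal.ofReal
        ((Metric.ball (x k) ε).indicator (fun z => ‖z - x k‖ ^ (-a)) z)) =
        (Metric.ball (x k) ε).indicator fun z => ENNReal.ofReal (‖z - x k‖ ^ (-a)) := by
      funext z
      by_cases hz : z ∈ Metric.ball (x k) ε <;> simp [hz]
    refine (lintegral_mono' Measure.restrict_le_self le_rfl).trans ?_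
    rw [e, lintegral_indicator measurableSet_ball, lintegral_ball_rpow _ hε0 (by linarith)]
    refine ENNReal.ofReal_le_ofReal ?_
    rw [hε2]
    refine mul_le_mul_of_nonneg_right ?_ (by positivity)
    exact div_le_self (by positivity) (by linarith)
  have hind₂ : ∀ k, ∫⁻ z in S, ENNReal.ofReal ((Metric.ball (x k) (r k)).indicator
      (fun z => r k ^ a * ‖z - x k‖ ^ (-(2 * a))) z) ≤
      ENNReal.ofReal (Real.pi / (1 - a) * (N * r k ^ 2 + N / n)) := by
    intro k
    have e : (fun z => ENNReal.ofReal ((Metric.ball (x k) (r k)).indicator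
        (fun z => r k ^ a * ‖z - x k‖ ^ (-(2 * a))) z)) =
        (Metric.ball (x k) (r k)).indicator fun z =>
          ENNReal.ofReal (r k ^ a) * ENNReal.ofReal (‖z - x k‖ ^ (-(2 * a))) := by
      funext z
      by_cases hz : z ∈ Metric.ball (x k) (r k) <;>
        simp [hz, ENNReal.ofReal_mul (Real.rpow_nonneg (hr0 k).le a)]
    refine (lintegral_mono' Measure.restrict_le_self le_rfl).trans ?_
    rw [e, lintegral_indicator measurableSet_ball, lintegral_const_mul' _ _ ENNReal.ofReal_ne_top,
      lintegral_ball_rpow _ (hr0 k) (by linarith),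
      ← ENNReal.ofReal_mul (Real.rpow_nonneg (hr0 k).le a)]
    refine ENNReal.ofReal_le_ofReal ?_
    have h1 : r k ^ a * (2 * Real.pi / (2 - 2 * a) * r k ^ (2 - 2 * a)) =
        Real.pi / (1 - a) * r k ^ (2 - a) := by
      have h2 : r k ^ (2 - a) = r k ^ a * r k ^ (2 - 2 * a) := by
        rw [← Real.rpow_add (hr0 k)]; congr 1; ring
      have h3 : 2 * Real.pi / (2 - 2 * a) = Real.pi / (1 - a) := by
        rw [show 2 - 2 * a = 2 * (1 - a) by ring, mul_div_mul_left _ _ (by norm_num)]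
      rw [h2, h3]
      ring
    rw [h1]
    refine mul_le_mul_of_nonneg_left ?_ (div_nonneg hpi.le (by linarith))
    -- For `r k ≥ ε` trade the power `-a` for `N` and keep `r k ^ 2` for the packing bound; for
    -- smaller `r k` the whole term is at most `N / n`.
    rcases le_total ε (r k) with h | h
    · have h2 : r k ^ (2 - a) = r k ^ (-a) * r k ^ 2 := by
        rw [← Real.rpow_two, ← Real.rpow_add (hr0 k)]; congr 1; ring
      have h3 : r k ^ (-a) ≤ N := hεa ▸ Real.rpow_le_rpow_of_nonpos hε0 h (by linarith)
      have h4 : r k ^ (-a) * r k ^ 2 ≤ N * r k ^ 2 :=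
        mul_le_mul_of_nonneg_right h3 (sq_nonneg _)
      rw [h2]
      have : 0 ≤ N / n := by positivity
      linarith
    · have h2 : r k ^ (2 - a) ≤ ε ^ (2 - a) := Real.rpow_le_rpow (hr0 k).le h (by linarith)
      rw [hε2] at h2
      have : 0 ≤ N * r k ^ 2 := by positivity
      linarith
  have hvol : volume S ≤ ENNReal.ofReal (Real.pi * D ^ 2) := by
    refine (measure_mono hS).trans ?_
    rw [Complex.volume_ball, ENNReal.ofReal_mul hpi.le, ENNReal.ofReal_pow hD, mul_comm]
    rw [← NNReal.coe_real_pi, ENNReal.ofReal_coe_nnreal]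
  simp only [hpt]
  rw [lintegral_add_left measurable_const, lintegral_add_left
    (Finset.measurable_fun_sum _ fun k _ => hm₁ k), lintegral_finsetSum _ fun k _ => hm₁ k,
    lintegral_finsetSum _ fun k _ => hm₂ k, setLIntegral_const]
  have hpack := sum_sq_nearestDist_le hδ hδ1 hD hx
  calc ENNReal.ofReal (δ ^ (-a) + N) * volume S + _ ≤
        ENNReal.ofReal (δ ^ (-a) + N) * ENNReal.ofReal (Real.pi * D ^ 2) +
        ((∑ _k : Fin n, ENNReal.ofReal (2 * Real.pi * (N / n))) +
        ∑ k, ENNReal.ofReal (Real.pi / (1 - a) * (N * r k ^ 2 + N / n))) := by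
        gcongr with k _ k _
        · exact hind₁ k
        · exact hind₂ k
    _ = ENNReal.ofReal ((δ ^ (-a) + N) * (Real.pi * D ^ 2) +
        ((∑ _k : Fin n, 2 * Real.pi * (N / n)) +
        ∑ k, Real.pi / (1 - a) * (N * r k ^ 2 + N / n))) := by
        have h1a : 0 < 1 - a := by linarith
        have hp1 : ∀ k ∈ Finset.univ, 0 ≤ Real.pi / (1 - a) * (N * r k ^ 2 + N / n) :=
          fun k _ => by positivity
        have hp2 : ∀ k ∈ (Finset.univ : Finset (Fin n)), 0 ≤ 2 * Real.pi * (N / n) :=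
          fun k _ => by positivity
        rw [ENNReal.ofReal_add (by positivity) (add_nonneg (Finset.sum_nonneg hp2)
          (Finset.sum_nonneg hp1)), ENNReal.ofReal_add (Finset.sum_nonneg hp2)
          (Finset.sum_nonneg hp1), ENNReal.ofReal_mul (p := δ ^ (-a) + N) (by positivity),
          ENNReal.ofReal_sum_of_nonneg hp1, ENNReal.ofReal_sum_of_nonneg hp2]
    _ ≤ _ := by
        refine ENNReal.ofReal_le_ofReal ?_
        have h1a : 0 < 1 - a := by linarith
        simp only [← Finset.mul_sum, Finset.sum_add_distrib, Finset.sum_const, Finset.card_univ, Fintype.card_fin, nsmul_eq_mul]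
        have e2 : (n : ℝ) * (N / n) = N := by field_simp
        rw [e2]
        have e3 : Real.pi / (1 - a) * (N * ∑ k, r k ^ 2 + N) ≤
            Real.pi / (1 - a) * (N * (4 * (D + 1) ^ 2) + N) := by gcongr
        have e4 : (δ ^ (-a) + N) * (Real.pi * D ^ 2) ≤
            (δ ^ (-a) * N + N) * (Real.pi * D ^ 2) := by
          gcongr
          exact le_mul_of_one_le_right hδa hN1
        linarith

open Classical in
/-- `nearestWeight`, restricted to configurations of distinct points. -/
noncomputable def nearestDensity (a δ : ℝ) {n : ℕ} (x : Fin n → ℂ) : ENNReal :=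
  if Function.Injective x then ENNReal.ofReal (nearestWeight a δ x) else 0

/-- Induction on the number of points, integrating out the last one first. A single point has weight
`δ ^ (-a)`; each further point multiplies the bound by `2 ^ 25 * B` times a power of the number of
points already present. -/
theorem lintegral_nearestDensity_le {a δ D B : ℝ} (ha : 0 ≤ a) (ha1 : a < 1) (hδ : 0 < δ)
    (hδ1 : δ ≤ 1) (hD : 0 ≤ D) {S : Set ℂ} (hSm : MeasurableSet S) (hS : S ⊆ Metric.ball 0 D)
    (hB : (δ ^ (-a) + 1) * (Real.pi * D ^ 2) + 2 * Real.pi +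
        Real.pi / (1 - a) * (4 * (D + 1) ^ 2 + 1) ≤ B) {x₁ : ℂ} (hx₁ : ‖x₁‖ < D) (m : ℕ) :
    ∫⁻ y, nearestDensity a δ (Fin.cons x₁ y : Fin (m + 1) → ℂ)
        ∂Measure.pi (fun _ : Fin m => volume.restrict S) ≤
      ENNReal.ofReal (δ ^ (-a) * (2 ^ 25 * B * ((m + 1 : ℕ) : ℝ) ^ (a / 2)) ^ m) := by
  have hpi := Real.pi_pos
  have h1a : 0 < 1 - a := by linarith
  have hδa : 0 ≤ δ ^ (-a) := Real.rpow_nonneg hδ.le _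
  have hB0 : 0 ≤ B := le_trans (by positivity) hB
  set ν : Measure ℂ := volume.restrict S with hν
  induction m with
  | zero =>
    have h1 : ∀ y : Fin 0 → ℂ, nearestDensity a δ (Fin.cons x₁ y : Fin 1 → ℂ) ≤
        ENNReal.ofReal (δ ^ (-a)) := by
      intro y
      unfold nearestDensity
      split_ifs with h
      · refine ENNReal.ofReal_le_ofReal ?_
        rw [nearestWeight, Fin.prod_univ_one, nearestDist]
        simp
      · simp
    calc _ ≤ ∫⁻ _, ENNReal.ofReal (δ ^ (-a)) ∂Measure.pi (fun _ : Fin 0 => ν) := lintegral_mono h1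
      _ = _ := by simp
  | succ m ih =>
    have hmp := (measurePreserving_piFinSuccAbove (fun _ : Fin (m + 1) => ν) (Fin.last m)).symm
    have hsw := Measure.measurePreserving_swap (μ := Measure.pi fun _ : Fin m => ν) (ν := ν)
    have hme : MeasurableEmbedding (Prod.swap : (Fin m → ℂ) × ℂ → ℂ × (Fin m → ℂ)) :=
      MeasurableEquiv.prodComm.measurableEmbedding
    rw [← hmp.lintegral_comp_emb (MeasurableEquiv.measurableEmbedding _),
      ← hsw.lintegral_comp_emb hme]
    -- This half of Tonelli's theorem needs no measurability of the density. The swap has made the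
    -- new point the inner variable.
    refine (lintegral_prod_le _).trans ?_
    set ε : ℝ := ((m + 1 : ℕ) : ℝ) ^ (-(1 / 2) : ℝ) with hε
    have hε0 : 0 < ε := Real.rpow_pos_of_pos (by positivity) _
    have hstep : ∀ (y : Fin m → ℂ) (z : ℂ), nearestDensity a δ (Fin.cons x₁
        ((MeasurableEquiv.piFinSuccAbove (fun _ : Fin (m + 1) => ℂ) (Fin.last m)).symm
          (Prod.swap (y, z))) : Fin (m + 1 + 1) → ℂ) ≤
        nearestDensity a δ (Fin.cons x₁ y : Fin (m + 1) → ℂ) *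
          (ENNReal.ofReal (2 ^ 25) *
          ENNReal.ofReal (nearestKernel a δ ε (Fin.cons x₁ y : Fin (m + 1) → ℂ) z)) := by
      intro y z
      set X : Fin (m + 1 + 1) → ℂ := Fin.cons x₁
        ((MeasurableEquiv.piFinSuccAbove (fun _ : Fin (m + 1) => ℂ) (Fin.last m)).symm
          (Prod.swap (y, z))) with hX
      have hXl : X (Fin.last (m + 1)) = z := by
        rw [hX, ← Fin.succ_last, Fin.cons_succ]
        simp [MeasurableEquiv.piFinSuccAbove]
      have hXc : (fun k : Fin (m + 1) => X k.castSucc) = Fin.cons x₁ y := by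
        funext k
        refine Fin.cases ?_ (fun j => ?_) k
        · simp [hX]
        · rw [hX, ← Fin.succ_castSucc, Fin.cons_succ, Fin.cons_succ]
          simp [MeasurableEquiv.piFinSuccAbove]
      unfold nearestDensity
      by_cases hi : Function.Injective X
      · have hi' : Function.Injective (Fin.cons x₁ y : Fin (m + 1) → ℂ) :=
          hXc ▸ hi.comp (Fin.castSucc_injective _)
        rw [if_pos hi, if_pos hi']
        have := nearestWeight_succ_le ha ha1.le hδ hε0 hi
        rw [hXl, hXc] at this
        rw [← ENNReal.ofReal_mul (by norm_num), ← ENNReal.ofReal_mul (nearestWeight_nonneg hδ)]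
        refine ENNReal.ofReal_le_ofReal (this.trans (le_of_eq (by ring)))
      · rw [if_neg hi]
        exact zero_le
    set M : ℝ := 2 ^ 25 * B * ((m + 1 : ℕ) : ℝ) ^ (a / 2) with hM
    have hM0 : 0 ≤ M := by positivity
    have hSae : ∀ᵐ y ∂Measure.pi (fun _ : Fin m => ν), ∀ k, y k ∈ S := by
      rw [ae_all_iff]
      intro k
      have : ∀ᵐ z ∂ν, z ∈ S := ae_restrict_mem hSm
      exact (Measure.tendsto_eval_ae_ae (μ := fun _ : Fin m => ν) (i := k)).eventually this
    have hinner : ∀ᵐ y ∂Measure.pi (fun _ : Fin m => ν),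
        ∫⁻ z, nearestDensity a δ (Fin.cons x₁
        ((MeasurableEquiv.piFinSuccAbove (fun _ : Fin (m + 1) => ℂ) (Fin.last m)).symm
          (Prod.swap (y, z))) : Fin (m + 1 + 1) → ℂ) ∂ν ≤
        nearestDensity a δ (Fin.cons x₁ y : Fin (m + 1) → ℂ) * ENNReal.ofReal M := by
      filter_upwards [hSae] with y hy
      refine (lintegral_mono (hstep y)).trans ?_
      by_cases hi : Function.Injective (Fin.cons x₁ y : Fin (m + 1) → ℂ)
      · have hne : nearestDensity a δ (Fin.cons x₁ y : Fin (m + 1) → ℂ) ≠ ⊤ := by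
          rw [nearestDensity, if_pos hi]; exact ENNReal.ofReal_ne_top
        rw [lintegral_const_mul' _ _ hne, lintegral_const_mul' _ _ ENNReal.ofReal_ne_top]
        gcongr
        have hxk : ∀ k, ‖(Fin.cons x₁ y : Fin (m + 1) → ℂ) k‖ < D := fun k => by
          refine Fin.cases ?_ (fun j => ?_) k
          · simpa using hx₁
          · simpa using hS (hy j)
        have := lintegral_nearestKernel_le ha ha1 hδ hδ1 hD (Nat.succ_pos m) hi hxk hS
        calc _ ≤ ENNReal.ofReal (2 ^ 25) * ENNReal.ofReal (B * ((m + 1 : ℕ) : ℝ) ^ (a / 2)) := by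
              gcongr
              exact this.trans (ENNReal.ofReal_le_ofReal
                (mul_le_mul_of_nonneg_right hB (by positivity)))
          _ = ENNReal.ofReal M := by
              rw [← ENNReal.ofReal_mul (by norm_num), hM, mul_assoc]
      · simp [nearestDensity, hi]
    refine (lintegral_mono_ae hinner).trans ?_
    rw [lintegral_mul_const' _ _ ENNReal.ofReal_ne_top]
    refine (mul_le_mul_left ih _).trans ?_
    rw [← ENNReal.ofReal_mul (by positivity)]
    refine ENNReal.ofReal_le_ofReal ?_
    rw [mul_assoc, ← pow_succ]
    refine mul_le_mul_of_nonneg_left ?_ hδa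
    refine pow_le_pow_left₀ hM0 ?_ _
    rw [hM]
    gcongr
    omega

/-! ### Consequences of the logarithmic singularity and of the electrostatic inequality. -/

/-- The properties of the Green's function that the estimates use: its logarithmic singularity,
the regularity of the remainder, and the electrostatic inequality. -/
structure IsLogKernel (Ω : Set ℂ) (c : ℝ) (g : ℂ → ℂ → ℝ) (B : ℝ) : Prop where
  eq : ∀ x ∈ Ω, ∀ y ∈ Ω, greenFunction Ω x y = c * Real.log ‖x - y‖⁻¹ + g x y
  continuousOn : ContinuousOn (Function.uncurry g) (Ω ×ˢ Ω)
  lipschitz : ∀ δ : ℝ, 0 < δ → ∃ L : ℝ, 0 ≤ L ∧ ∀ x y x' y' : ℂ,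
    Metric.closedBall x (2 * δ) ⊆ Ω → Metric.closedBall y (2 * δ) ⊆ Ω → ‖x' - x‖ < δ →
      ‖y' - y‖ < δ → |g x' y' - g x y| ≤ L * (‖x' - x‖ + ‖y' - y‖)
  nonneg : 0 ≤ B
  electrostatic : ∀ {n : ℕ} (α : Fin n → ℝ) (x : Fin n → ℂ) (r : Fin n → ℝ), (∀ k, 0 < r k) →
    (∀ k, r k ≤ 1) → (∀ k, Metric.closedBall (x k) (r k) ⊆ Ω) →
    (∀ k l, k ≠ l → r k + r l ≤ ‖x k - x l‖) →
    -coulombEnergy Ω α x ≤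
      1 / 2 * ∑ k, α k ^ 2 * (B - 1 / (2 * Real.pi) * Real.log (r k))

/-- With a regular part the constant is `c = 1 / (2π)`; without one `greenFunction` is zero by its
default value, and `c = 0` serves. In that case the electrostatic bound only says that the right
side is nonnegative, which holds as the radii are at most 1. -/
theorem exists_isLogKernel {Ω : Set ℂ} (ho : IsOpen Ω) (hb : Bornology.IsBounded Ω) :
    ∃ c g B, IsLogKernel Ω c g B := by
  have hpi := Real.pi_pos
  by_cases h : ∃ g, IsGreenRegularPart Ω g
  · obtain ⟨g, hg⟩ := h
    set D := Metric.diam (closure Ω) with hDdef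
    have hD : ∀ x ∈ closure Ω, ∀ y ∈ closure Ω, ‖x - y‖ ≤ D := fun x hx y hy => by
      rw [← dist_eq_norm]; exact Metric.dist_le_diam_of_mem hb.closure hx hy
    refine ⟨1 / (2 * Real.pi), g,
      max 0 (1 / (2 * Real.pi) * Real.log D + 3 / (8 * Real.pi)), ?_, ?_, ?_, ?_, ?_⟩
    · exact fun x hx y hy => greenFunction_eq ho hb hg hx hy
    · exact hg.continuousOn_uncurry ho hb
    · exact fun δ hδ => hg.exists_lipschitz ho hb hδ
    · exact le_max_left _ _
    · intro n α x r hr _ hball hsep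
      refine (neg_coulombEnergy_le ho hb hg α x r hr hball hsep).trans ?_
      gcongr with k _
      have hk := center_mem_of_closedBall_subset (hr k) (hball k)
      have h1 := hg.le ho hb hD (subset_closure hk) hk
      have h2 := le_max_right 0 (1 / (2 * Real.pi) * Real.log D + 3 / (8 * Real.pi))
      linarith
  · have h0 : ∀ x y, greenFunction Ω x y = 0 := fun x y => by rw [greenFunction, dif_neg h]
    refine ⟨0, fun _ _ => 0, 0, ?_, ?_, ?_, le_rfl, ?_⟩
    · intro x _ y _
      simp [h0]
    · exact continuousOn_const
    · exact fun δ _ => ⟨0, le_rfl, by simp⟩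
    · intro n α x r hr hr1 _ _
      simp only [coulombEnergy, h0, mul_zero, Finset.sum_const_zero, neg_zero]
      refine mul_nonneg (by norm_num) (Finset.sum_nonneg fun k _ => mul_nonneg (sq_nonneg _) ?_)
      have := Real.log_nonpos (hr k).le (hr1 k)
      have h2 : 0 ≤ 1 / (2 * Real.pi) * -Real.log (r k) := mul_nonneg (by positivity) (by linarith)
      linarith

namespace IsLogKernel

variable {Ω : Set ℂ} {c : ℝ} {g : ℂ → ℂ → ℝ} {B : ℝ} (hG : IsLogKernel Ω c g B)

include hG

/-- Apply the electrostatic inequality with half the nearest distances as radii, which makes the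
discs disjoint. The halving produces the factor `2 ^ a` per point. -/
theorem exp_neg_coulombEnergy_le {κ δ : ℝ} (hδ : 0 < δ) (hδ1 : δ ≤ 1) {n : ℕ} {α : Fin n → ℝ}
    (hα : ∀ k, |α k| ≤ κ) {x : Fin n → ℂ} (hx : Function.Injective x)
    (hball : ∀ k, Metric.closedBall (x k) δ ⊆ Ω) :
    Real.exp (-coulombEnergy Ω α x) ≤
      (Real.exp (κ ^ 2 * B / 2) * 2 ^ (κ ^ 2 / (4 * Real.pi))) ^ n *
        nearestWeight (κ ^ 2 / (4 * Real.pi)) δ x := by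
  have hpi := Real.pi_pos
  set a := κ ^ 2 / (4 * Real.pi) with ha
  set s : Fin n → ℝ := nearestDist δ x with hs
  have hs0 : ∀ k, 0 < s k := fun k => nearestDist_pos hδ hx
  have hsδ : ∀ k, s k ≤ δ := fun k => nearestDist_le_cap
  have h1 := hG.electrostatic α x (fun k => s k / 2) (fun k => half_pos (hs0 k))
    (fun k => by linarith [hsδ k, hs0 k])
    (fun k => (Metric.closedBall_subset_closedBall (by linarith [hsδ k, hs0 k])).trans (hball k))
    (fun k l hkl => by
      have h2 : s k ≤ ‖x k - x l‖ := nearestDist_le hkl.symm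
      have h3 : s l ≤ ‖x l - x k‖ := nearestDist_le hkl
      rw [norm_sub_rev] at h3
      linarith)
  have hterm : ∀ k, Real.exp (1 / 2 * (α k ^ 2 * (B - 1 / (2 * Real.pi) * Real.log (s k / 2)))) ≤
      Real.exp (κ ^ 2 * B / 2) * 2 ^ a * s k ^ (-a) := by
    intro k
    have hlog : Real.log (s k / 2) ≤ 0 :=
      Real.log_nonpos (half_pos (hs0 k)).le (by linarith [hsδ k, hs0 k])
    have hα2 : α k ^ 2 ≤ κ ^ 2 := by
      rw [← sq_abs (α k)]
      exact pow_le_pow_left₀ (abs_nonneg _) (hα k) 2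
    -- The sign of the bracket is what allows `α k ^ 2` to be replaced by `κ ^ 2`.
    have h2 : 0 ≤ B - 1 / (2 * Real.pi) * Real.log (s k / 2) := by
      have h3 : 0 ≤ 1 / (2 * Real.pi) * -Real.log (s k / 2) :=
        mul_nonneg (by positivity) (by linarith)
      have := hG.nonneg
      linarith
    calc Real.exp (1 / 2 * (α k ^ 2 * (B - 1 / (2 * Real.pi) * Real.log (s k / 2))))
        ≤ Real.exp (1 / 2 * (κ ^ 2 * (B - 1 / (2 * Real.pi) * Real.log (s k / 2)))) := by
          gcongr
      _ = Real.exp (κ ^ 2 * B / 2 + (Real.log 2 * a + Real.log (s k) * (-a))) := by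
          congr 1
          rw [Real.log_div (hs0 k).ne' (by norm_num), ha]
          field_simp
          ring
      _ = Real.exp (κ ^ 2 * B / 2) * 2 ^ a * s k ^ (-a) := by
          rw [Real.exp_add, Real.exp_add, Real.rpow_def_of_pos (by norm_num),
            Real.rpow_def_of_pos (hs0 k), mul_assoc]
  calc Real.exp (-coulombEnergy Ω α x)
      ≤ Real.exp (∑ k, 1 / 2 * (α k ^ 2 * (B - 1 / (2 * Real.pi) * Real.log (s k / 2)))) := by
        rw [← Finset.mul_sum]
        exact Real.exp_le_exp.2 h1
    _ = ∏ k, Real.exp (1 / 2 * (α k ^ 2 * (B - 1 / (2 * Real.pi) * Real.log (s k / 2)))) :=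
        Real.exp_sum _ _
    _ ≤ ∏ k, Real.exp (κ ^ 2 * B / 2) * 2 ^ a * s k ^ (-a) :=
        Finset.prod_le_prod (fun k _ => (Real.exp_pos _).le) fun k _ => hterm k
    _ = _ := by
        rw [Finset.prod_mul_distrib]
        simp [nearestWeight, hs]

/-- A common translation preserves all differences, so the singular logarithms cancel and only the
regular part changes, in at most `n ^ 2` pairs. -/
theorem abs_coulombEnergy_add_sub_le {κ δ L : ℝ} (hδ : 0 < δ)
    (hL : ∀ x y x' y' : ℂ, Metric.closedBall x (2 * δ) ⊆ Ω → Metric.closedBall y (2 * δ) ⊆ Ω →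
      ‖x' - x‖ < δ → ‖y' - y‖ < δ → |g x' y' - g x y| ≤ L * (‖x' - x‖ + ‖y' - y‖))
    (hL0 : 0 ≤ L) {n : ℕ} {α : Fin n → ℝ} (hα : ∀ k, |α k| ≤ κ) {x : Fin n → ℂ}
    (hball : ∀ k, Metric.closedBall (x k) (2 * δ) ⊆ Ω) {h : ℂ} (hh : ‖h‖ < δ) :
    |coulombEnergy Ω α (fun k => x k + h) - coulombEnergy Ω α x| ≤
      2 * κ ^ 2 * L * ((n : ℝ) ^ 2 * ‖h‖) := by
  have hmem : ∀ k, x k ∈ Ω := fun k =>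
    center_mem_of_closedBall_subset (by positivity) (hball k)
  have hmem' : ∀ k, x k + h ∈ Ω := fun k => hball k (by
    rw [Metric.mem_closedBall, dist_eq_norm, add_sub_cancel_left]; linarith)
  have hdiff : coulombEnergy Ω α (fun k => x k + h) - coulombEnergy Ω α x =
      ∑ k, ∑ l ∈ Finset.Ioi k, α k * α l * (g (x k + h) (x l + h) - g (x k) (x l)) := by
    rw [coulombEnergy, coulombEnergy, ← Finset.sum_sub_distrib]
    refine Finset.sum_congr rfl fun k _ => ?_
    rw [← Finset.sum_sub_distrib]
    refine Finset.sum_congr rfl fun l _ => ?_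
    rw [hG.eq _ (hmem' k) _ (hmem' l), hG.eq _ (hmem k) _ (hmem l), add_sub_add_right_eq_sub]
    ring
  have hterm : ∀ k l, |α k * α l * (g (x k + h) (x l + h) - g (x k) (x l))| ≤
      κ ^ 2 * (L * (2 * ‖h‖)) := by
    intro k l
    have h1 := hL (x k) (x l) (x k + h) (x l + h) (hball k) (hball l)
      (by rwa [add_sub_cancel_left]) (by rwa [add_sub_cancel_left])
    rw [add_sub_cancel_left, add_sub_cancel_left, ← two_mul] at h1
    rw [abs_mul, abs_mul, sq]
    have hκ : 0 ≤ κ := (abs_nonneg _).trans (hα k)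
    exact mul_le_mul (mul_le_mul (hα k) (hα l) (abs_nonneg _) hκ) h1 (abs_nonneg _)
      (mul_nonneg hκ hκ)
  have hnn : 0 ≤ κ ^ 2 * (L * (2 * ‖h‖)) := by positivity
  rw [hdiff]
  calc |∑ k, ∑ l ∈ Finset.Ioi k, α k * α l * (g (x k + h) (x l + h) - g (x k) (x l))|
      ≤ ∑ k, ∑ l ∈ Finset.Ioi k, |α k * α l * (g (x k + h) (x l + h) - g (x k) (x l))| :=
        (Finset.abs_sum_le_sum_abs _ _).trans
          (Finset.sum_le_sum fun k _ => Finset.abs_sum_le_sum_abs _ _)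
    _ ≤ ∑ _k : Fin n, ∑ _l : Fin n, κ ^ 2 * (L * (2 * ‖h‖)) :=
        Finset.sum_le_sum fun k _ => (Finset.sum_le_sum fun l _ => hterm k l).trans
          (Finset.sum_le_sum_of_subset_of_nonneg (Finset.subset_univ _) fun _ _ _ => hnn)
    _ = 2 * κ ^ 2 * L * ((n : ℝ) ^ 2 * ‖h‖) := by
        simp only [Finset.sum_const, Finset.card_univ, Fintype.card_fin, nsmul_eq_mul]
        ring

/-- The regular part is controlled only on `Ω × Ω`, so measurability is obtained on `Ω^m`, where the
energy is a combination of logarithms and a jointly continuous function. -/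
theorem aestronglyMeasurable_onePointIntegrand (ho : IsOpen Ω) {m : ℕ} (α : Fin (m + 1) → ℝ)
    {f : Fin m → ℂ → ℂ} (hf : ∀ j, Continuous (f j)) {x₁ : ℂ} (hx₁ : x₁ ∈ Ω) :
    AEStronglyMeasurable (onePointIntegrand Ω α f x₁)
      (volume.restrict (Set.univ.pi fun _ : Fin m => Ω)) := by
  have hms : MeasurableSet (Set.univ.pi fun _ : Fin m => Ω) :=
    MeasurableSet.univ_pi fun _ => ho.measurableSet
  have hcons : ∀ k, Continuous fun y : Fin m → ℂ => (Fin.cons x₁ y : Fin (m + 1) → ℂ) k := by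
    intro k
    refine Fin.cases ?_ (fun j => ?_) k
    · simpa using continuous_const
    · simpa using continuous_apply j
  have hmem : ∀ y ∈ Set.univ.pi fun _ : Fin m => Ω, ∀ k,
      (Fin.cons x₁ y : Fin (m + 1) → ℂ) k ∈ Ω := by
    intro y hy k
    refine Fin.cases ?_ (fun j => ?_) k
    · simpa using hx₁
    · simpa using hy j (Set.mem_univ j)
  have hgreen : ∀ k l, AEMeasurable (fun y : Fin m → ℂ =>
      greenFunction Ω ((Fin.cons x₁ y : Fin (m + 1) → ℂ) k) ((Fin.cons x₁ y : Fin (m + 1) → ℂ) l))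
      (volume.restrict (Set.univ.pi fun _ : Fin m => Ω)) := by
    intro k l
    have h1 : AEMeasurable (fun y : Fin m → ℂ => c * Real.log
        ‖(Fin.cons x₁ y : Fin (m + 1) → ℂ) k - (Fin.cons x₁ y : Fin (m + 1) → ℂ) l‖⁻¹)
        (volume.restrict (Set.univ.pi fun _ : Fin m => Ω)) :=
      (((Real.measurable_log.comp ((hcons k).sub (hcons l)).norm.measurable.inv).const_mul
        c)).aemeasurable
    have h2 : AEMeasurable (fun y : Fin m → ℂ => g ((Fin.cons x₁ y : Fin (m + 1) → ℂ) k)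
        ((Fin.cons x₁ y : Fin (m + 1) → ℂ) l))
        (volume.restrict (Set.univ.pi fun _ : Fin m => Ω)) := by
      have h3 : ContinuousOn (fun y : Fin m → ℂ => Function.uncurry g
          ((Fin.cons x₁ y : Fin (m + 1) → ℂ) k, (Fin.cons x₁ y : Fin (m + 1) → ℂ) l))
          (Set.univ.pi fun _ : Fin m => Ω) :=
        hG.continuousOn.comp ((hcons k).prodMk (hcons l)).continuousOn
          fun y hy => ⟨hmem y hy k, hmem y hy l⟩
      exact h3.aemeasurable hms
    refine (h1.add h2).congr ?_
    filter_upwards [ae_restrict_mem hms] with y hy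
    exact (hG.eq _ (hmem y hy k) _ (hmem y hy l)).symm
  have hen : AEMeasurable (fun y : Fin m → ℂ =>
      coulombEnergy Ω α (Fin.cons x₁ y : Fin (m + 1) → ℂ))
      (volume.restrict (Set.univ.pi fun _ : Fin m => Ω)) := by
    unfold coulombEnergy
    exact Finset.aemeasurable_fun_sum _ fun k _ => Finset.aemeasurable_fun_sum _ fun l _ =>
      (hgreen k l).const_mul _
  have hprod : Continuous fun y : Fin m → ℂ => ∏ j, f j (y j) :=
    continuous_finsetProd _ fun j _ => (hf j).comp (continuous_apply j)
  exact hprod.aestronglyMeasurable.mul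
    (Complex.measurable_ofReal.comp_aemeasurable
      (Real.measurable_exp.comp_aemeasurable hen.neg)).aestronglyMeasurable

end IsLogKernel

/-! ### Null sets and elementary increment estimates. -/

/-- Coincidences lie in finitely many null sets: a fixed coordinate value, or the kernel of a
difference of coordinates. The electrostatic bound is available for distinct points only. -/
theorem ae_injective_cons (x₁ : ℂ) (m : ℕ) :
    ∀ᵐ y : Fin m → ℂ, Function.Injective (Fin.cons x₁ y : Fin (m + 1) → ℂ) := by
  have h1 : ∀ᵐ y : Fin m → ℂ, ∀ j, y j ≠ x₁ := by
    rw [ae_all_iff]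
    intro j
    rw [volume_pi]
    exact Measure.ae_eval_ne (fun _ : Fin m => (volume : Measure ℂ)) j x₁
  have h2 : ∀ᵐ y : Fin m → ℂ, ∀ i j, i ≠ j → y i ≠ y j := by
    simp only [ae_all_iff]
    intro i j hij
    set V : Submodule ℝ (Fin m → ℂ) :=
      LinearMap.ker ((LinearMap.proj i : (Fin m → ℂ) →ₗ[ℝ] ℂ) - LinearMap.proj j) with hV
    have hVtop : V ≠ ⊤ := by
      intro h
      have : (Pi.single i 1 : Fin m → ℂ) ∈ V := h ▸ Submodule.mem_top
      rw [hV, LinearMap.mem_ker] at this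
      simp [hij.symm] at this
    have h3 := Measure.addHaar_submodule volume V hVtop
    refine measure_mono_null ?_ h3
    intro y hy
    simp only [Set.mem_compl_iff, ne_eq] at hy
    simpa [hV, LinearMap.mem_ker, sub_eq_zero] using hy
  filter_upwards [h1, h2] with y hy1 hy2
  rw [Fin.cons_injective_iff]
  refine ⟨fun ⟨j, hj⟩ => hy1 j hj, fun i j hij => ?_⟩
  by_contra h
  exact hy2 i j h hij

/-- Telescoping. One `M` bounds both sizes and relative increments, so every telescoped term carries
the same power of `M`. -/
theorem norm_prod_sub_prod_le {ι : Type*} (s : Finset ι) {a b : ι → ℂ} {M e : ℝ}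
    (ha : ∀ i ∈ s, ‖a i‖ ≤ M) (hb : ∀ i ∈ s, ‖b i‖ ≤ M) (hab : ∀ i ∈ s, ‖a i - b i‖ ≤ M * e)
    (hM : 0 ≤ M) : ‖∏ i ∈ s, a i - ∏ i ∈ s, b i‖ ≤ s.card * (M ^ s.card * e) := by
  classical
  induction s using Finset.induction_on with
  | empty => simp
  | insert i s hi ih =>
    rw [Finset.prod_insert hi, Finset.prod_insert hi, Finset.card_insert_of_notMem hi]
    have h1 := ih (fun j hj => ha j (Finset.mem_insert_of_mem hj))
      (fun j hj => hb j (Finset.mem_insert_of_mem hj))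
      (fun j hj => hab j (Finset.mem_insert_of_mem hj))
    have h2 : ‖∏ j ∈ s, b j‖ ≤ M ^ s.card := by
      rw [norm_prod]
      calc ∏ j ∈ s, ‖b j‖ ≤ ∏ _j ∈ s, M := Finset.prod_le_prod (fun j _ => norm_nonneg _)
            fun j hj => hb j (Finset.mem_insert_of_mem hj)
        _ = M ^ s.card := by simp
    have e1 : a i * ∏ j ∈ s, a j - b i * ∏ j ∈ s, b j =
        a i * (∏ j ∈ s, a j - ∏ j ∈ s, b j) + (a i - b i) * ∏ j ∈ s, b j := by ring
    rw [e1]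
    have hai := ha i (Finset.mem_insert_self i s)
    have habi := hab i (Finset.mem_insert_self i s)
    calc _ ≤ ‖a i‖ * ‖∏ j ∈ s, a j - ∏ j ∈ s, b j‖ + ‖a i - b i‖ * ‖∏ j ∈ s, b j‖ := by
          refine (norm_add_le _ _).trans ?_
          rw [norm_mul, norm_mul]
      _ ≤ M * (s.card * (M ^ s.card * e)) + M * e * M ^ s.card :=
          add_le_add (mul_le_mul hai h1 (norm_nonneg _) hM)
            (mul_le_mul habi h2 (norm_nonneg _) ((norm_nonneg _).trans habi))
      _ = _ := by push_cast; ring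

theorem cons_add_const {m : ℕ} (x₁ h : ℂ) (y : Fin m → ℂ) :
    (Fin.cons (x₁ + h) (y + fun _ => h) : Fin (m + 1) → ℂ) =
      fun k => (Fin.cons x₁ y : Fin (m + 1) → ℂ) k + h := by
  funext k
  refine Fin.cases ?_ (fun j => ?_) k <;> simp

theorem onePointIntegrand_eq_zero {Ω : Set ℂ} {m : ℕ} {α : Fin (m + 1) → ℝ}
    {f : Fin m → ℂ → ℂ} {x₁ : ℂ} {y : Fin m → ℂ} {j : Fin m} (hj : f j (y j) = 0) :
    onePointIntegrand Ω α f x₁ y = 0 := by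
  rw [onePointIntegrand, Finset.prod_eq_zero (Finset.mem_univ j) hj, zero_mul]

theorem norm_onePointIntegrand {Ω : Set ℂ} {m : ℕ} (α : Fin (m + 1) → ℝ)
    (f : Fin m → ℂ → ℂ) (x₁ : ℂ) (y : Fin m → ℂ) :
    ‖onePointIntegrand Ω α f x₁ y‖ =
      (∏ j, ‖f j (y j)‖) * Real.exp (-coulombEnergy Ω α (Fin.cons x₁ y : Fin (m + 1) → ℂ)) := by
  rw [onePointIntegrand, norm_mul, norm_prod, Complex.norm_real, Real.norm_eq_abs,
    abs_of_pos (Real.exp_pos _)]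

/-- With `s = n^2 * ‖h‖ ≤ 1` the exponential stays below `exp A`, independently of the number of
points. -/
theorem abs_exp_neg_sub_one_le {t A s : ℝ} (hs : s ≤ 1) (hs0 : 0 ≤ s) (hA : 0 ≤ A)
    (h : |t| ≤ A * s) : |Real.exp (-t) - 1| ≤ A * Real.exp A * s := by
  have h1 : |Real.exp (-t) - 1| ≤ |t| * Real.exp |t| := by
    rw [abs_le]
    constructor
    · have h2 := Real.add_one_le_exp (-t)
      have h3 := le_abs_self t
      have h4 : |t| * 1 ≤ |t| * Real.exp |t| :=
        mul_le_mul_of_nonneg_left (Real.one_le_exp (abs_nonneg t)) (abs_nonneg t)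
      linarith
    · have h2 := Real.add_one_le_exp t
      have h5 : Real.exp (-t) - 1 = Real.exp (-t) * (1 - Real.exp t) := by
        rw [mul_sub, ← Real.exp_add]; simp
      have h6 : Real.exp (-t) * (1 - Real.exp t) ≤ Real.exp (-t) * |t| :=
        mul_le_mul_of_nonneg_left (by linarith [neg_abs_le t]) (Real.exp_pos _).le
      have h7 : Real.exp (-t) * |t| ≤ Real.exp |t| * |t| :=
        mul_le_mul_of_nonneg_right (Real.exp_le_exp.2 (neg_le_abs t)) (abs_nonneg t)
      rw [h5]
      linarith
  have h2 : |t| ≤ A := h.trans (mul_le_of_le_one_right hA hs)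
  calc |Real.exp (-t) - 1| ≤ |t| * Real.exp |t| := h1
    _ ≤ (A * s) * Real.exp A := by gcongr
    _ = _ := by ring

/-! ### Bounds on the one-point function and its increments. -/

namespace IsLogKernel

variable {Ω : Set ℂ} {c : ℝ} {g : ℂ → ℂ → ℝ} {B : ℝ} (hG : IsLogKernel Ω c g B)

include hG

/-- Combines the pointwise bound by the weight with the integrated weight. Only `m` of the `m + 1`
points are integrated; the bases are enlarged to at least 1 so that every factor may carry the power
`m + 1`. -/
theorem exists_lintegral_exp_le (hb : Bornology.IsBounded Ω) {κ δ : ℝ} (hκ : 0 ≤ κ)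
    (hκ1 : κ < Real.sqrt (4 * Real.pi)) (hδ : 0 < δ) (hδ1 : δ ≤ 1) {T : Set ℂ}
    (hTm : MeasurableSet T) (hT : ∀ z ∈ T, Metric.closedBall z δ ⊆ Ω) :
    ∃ C : ℝ, 1 ≤ C ∧ ∀ (m : ℕ) (α : Fin (m + 1) → ℝ), (∀ k, |α k| ≤ κ) → ∀ x₁ ∈ T,
      ∫⁻ y in Set.univ.pi fun _ : Fin m => T,
        ENNReal.ofReal (Real.exp (-coulombEnergy Ω α (Fin.cons x₁ y : Fin (m + 1) → ℂ))) ≤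
      ENNReal.ofReal (C ^ (m + 1) *
        ((m + 1 : ℕ) : ℝ) ^ (κ ^ 2 / (8 * Real.pi) * ((m + 1 : ℕ) : ℝ))) := by
  have hpi := Real.pi_pos
  set a := κ ^ 2 / (4 * Real.pi) with ha
  have ha0 : 0 ≤ a := by positivity
  have ha1 : a < 1 := by
    rw [ha, div_lt_one (by positivity)]
    exact (Real.lt_sqrt hκ).1 hκ1
  obtain ⟨D, hD0, hD⟩ : ∃ D : ℝ, 0 < D ∧ Ω ⊆ Metric.ball 0 D := by
    obtain ⟨D, hD⟩ := hb.subset_ball 0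
    exact ⟨max D 1, by positivity, hD.trans (Metric.ball_subset_ball (le_max_left _ _))⟩
  have hTΩ : T ⊆ Ω := fun z hz => hT z hz (Metric.mem_closedBall_self hδ.le)
  set A := Real.exp (κ ^ 2 * B / 2) * 2 ^ a with hA
  have hA0 : 0 ≤ A := by positivity
  set E := (δ ^ (-a) + 1) * (Real.pi * D ^ 2) + 2 * Real.pi +
        Real.pi / (1 - a) * (4 * (D + 1) ^ 2 + 1) with hE
  have h1a : 0 < 1 - a := by linarith
  have hE0 : 0 ≤ E := by positivity
  have hδa : 1 ≤ δ ^ (-a) := Real.one_le_rpow_of_pos_of_le_one_of_nonpos hδ hδ1 (by linarith)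
  have hE1 : 1 ≤ 2 ^ 25 * E + 1 := by linarith
  refine ⟨(A + 1) * (δ ^ (-a) * (2 ^ 25 * E + 1)), ?_, ?_⟩
  · exact one_le_mul_of_one_le_of_one_le (by linarith) (one_le_mul_of_one_le_of_one_le hδa hE1)
  intro m α hα x₁ hx₁
  have hpim : MeasurableSet (Set.univ.pi fun _ : Fin m => T) := MeasurableSet.univ_pi fun _ => hTm
  have hpt : ∀ᵐ y ∂volume.restrict (Set.univ.pi fun _ : Fin m => T),
      ENNReal.ofReal (Real.exp (-coulombEnergy Ω α (Fin.cons x₁ y : Fin (m + 1) → ℂ))) ≤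
        ENNReal.ofReal (A ^ (m + 1)) * nearestDensity a δ (Fin.cons x₁ y : Fin (m + 1) → ℂ) := by
    filter_upwards [ae_restrict_of_ae (ae_injective_cons x₁ m), ae_restrict_mem hpim] with y hy hyT
    rw [nearestDensity, if_pos hy, ← ENNReal.ofReal_mul (by positivity)]
    refine ENNReal.ofReal_le_ofReal
      (hG.exp_neg_coulombEnergy_le hδ hδ1 hα hy fun k => hT _ ?_)
    refine Fin.cases ?_ (fun j => ?_) k
    · simpa using hx₁
    · simpa using hyT j (Set.mem_univ j)
  refine (lintegral_mono_ae hpt).trans ?_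
  rw [lintegral_const_mul' _ _ ENNReal.ofReal_ne_top, volume_pi, Measure.restrict_pi_pi]
  have hx₁D : ‖x₁‖ < D := by simpa using hD (hTΩ hx₁)
  refine (mul_le_mul_right (lintegral_nearestDensity_le ha0 ha1 hδ hδ1 hD0.le hTm (hTΩ.trans hD)
    le_rfl hx₁D m) _).trans ?_
  rw [← ENNReal.ofReal_mul (by positivity), ← hE]
  refine ENNReal.ofReal_le_ofReal ?_
  set N : ℝ := ((m + 1 : ℕ) : ℝ) with hN
  have hN1 : 1 ≤ N := by rw [hN]; exact_mod_cast Nat.succ_pos m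
  have hNa : 1 ≤ N ^ (a / 2) := Real.one_le_rpow hN1 (by linarith)
  have hexp : N ^ (κ ^ 2 / (8 * Real.pi) * N) = (N ^ (a / 2)) ^ (m + 1) := by
    rw [← Real.rpow_natCast (N ^ (a / 2)), ← Real.rpow_mul (by linarith), ← hN, ha]
    congr 2
    field_simp
    ring
  rw [hexp, mul_pow (A + 1), mul_pow (δ ^ (-a)), mul_pow (2 ^ 25 * E)]
  calc A ^ (m + 1) * (δ ^ (-a) * ((2 ^ 25 * E) ^ m * (N ^ (a / 2)) ^ m))
      ≤ (A + 1) ^ (m + 1) * ((δ ^ (-a)) ^ (m + 1) *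
        ((2 ^ 25 * E + 1) ^ (m + 1) * (N ^ (a / 2)) ^ (m + 1))) := by
        gcongr
        · linarith
        · exact le_self_pow₀ hδa (by omega)
        · calc (2 ^ 25 * E) ^ m ≤ (2 ^ 25 * E + 1) ^ m := by gcongr; linarith
            _ ≤ (2 ^ 25 * E + 1) ^ (m + 1) := pow_le_pow_right₀ hE1 (by omega)
        · omega
    _ = _ := by ring

/-- Integrability, and bounds on the values and on the increments of the one-point function. -/
theorem exists_onePointIntegral_bounds (ho : IsOpen Ω) (hb : Bornology.IsBounded Ω) {κ : ℝ}
    (hκ : 0 ≤ κ) (hκ1 : κ < Real.sqrt (4 * Real.pi)) {K S : Set ℂ} (hK : IsCompact K)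
    (hKΩ : K ⊆ Ω) (hS : IsCompact S) (hSΩ : S ⊆ Ω) {M : ℝ} (hM : 0 ≤ M) :
    ∃ C : ℝ, 1 ≤ C ∧ ∀ (m : ℕ) (α : Fin (m + 1) → ℝ) (f : Fin m → ℂ → ℂ),
      (∀ k, |α k| ≤ κ) → (∀ j, Continuous (f j)) → (∀ j, tsupport (f j) ⊆ S) →
      (∀ j, ∀ z ∈ Ω, ‖f j z‖ ≤ M) → (∀ j, ∀ z ∈ Ω, ∀ w ∈ Ω, ‖f j z - f j w‖ ≤ M * ‖z - w‖) →
      (∀ x₁ ∈ K, IntegrableOn (onePointIntegrand Ω α f x₁) (Set.univ.pi fun _ : Fin m => Ω)) ∧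
      ∀ P : ℝ, P = C ^ (m + 1) *
        ((m + 1 : ℕ) : ℝ) ^ (κ ^ 2 / (8 * Real.pi) * ((m + 1 : ℕ) : ℝ)) →
      (∀ x ∈ K, ‖onePointIntegral Ω α f x‖ ≤ P) ∧
      ∀ x ∈ K, ∀ x' ∈ K, ‖onePointIntegral Ω α f x' - onePointIntegral Ω α f x‖ ≤
        P * ‖x' - x‖ := by
  obtain ⟨δ₀, hδ₀, hδ₀Ω⟩ := (hK.union hS).exists_cthickening_subset_open ho
    (Set.union_subset hKΩ hSΩ)
  -- One `δ` thickens `K ∪ S` to `T`, which leaves room for translations shorter than `δ`, and two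
  -- more keep the discs of radius `2 * δ` around points of `T` inside `Ω`.
  set δ := min 1 (δ₀ / 3) with hδdef
  have hδ : 0 < δ := by positivity
  have hδ1 : δ ≤ 1 := min_le_left _ _
  have hδ3 : 3 * δ ≤ δ₀ := by
    have : δ ≤ δ₀ / 3 := min_le_right _ _
    linarith
  set T := Metric.cthickening δ (K ∪ S) with hT
  have hTm : MeasurableSet T := Metric.isClosed_cthickening.measurableSet
  have hmemT : ∀ w ∈ K ∪ S, ∀ z, ‖z - w‖ ≤ δ → z ∈ T := fun w hw z hz =>
    Metric.mem_cthickening_of_dist_le z w δ _ hw (by rwa [dist_eq_norm])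
  have hTball : ∀ z ∈ T, Metric.closedBall z (2 * δ) ⊆ Ω := by
    intro z hz w hw
    rw [hT, (hK.union hS).cthickening_eq_biUnion_closedBall hδ.le] at hz
    simp only [Set.mem_iUnion] at hz
    obtain ⟨v, hv, hzv⟩ := hz
    refine hδ₀Ω (Metric.mem_cthickening_of_dist_le w v δ₀ _ hv ?_)
    rw [Metric.mem_closedBall] at hw hzv
    linarith [dist_triangle w z v]
  have hTΩ : T ⊆ Ω := fun z hz => hTball z hz (Metric.mem_closedBall_self (by positivity))
  have hKT : K ⊆ T := fun z hz => hmemT z (Or.inl hz) z (by simp [hδ.le])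
  have hST : S ⊆ T := fun z hz => hmemT z (Or.inr hz) z (by simp [hδ.le])
  obtain ⟨C, hC1, hC⟩ := hG.exists_lintegral_exp_le hb hκ hκ1 hδ hδ1 hTm fun z hz =>
    (Metric.closedBall_subset_closedBall (by linarith)).trans (hTball z hz)
  obtain ⟨L, hL0, hL⟩ := hG.lipschitz δ hδ
  set A := 2 * κ ^ 2 * L with hA
  have hA0 : 0 ≤ A := by positivity
  -- `A * exp A` comes from the change of the energy, a summand 1 from the change of the `f j`, and
  -- `2 / δ` serves the increments that are not small.
  set Q := 2 + A * Real.exp A + 2 / δ with hQ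
  have hQ1 : 1 ≤ Q := by
    have h1 : 0 ≤ A * Real.exp A := by positivity
    have h2 : 0 ≤ 2 / δ := by positivity
    linarith
  refine ⟨C * ((M + 1) * (4 * Q)), ?_, ?_⟩
  · exact one_le_mul_of_one_le_of_one_le hC1
      (one_le_mul_of_one_le_of_one_le (by linarith) (by linarith))
  intro m α f hα hfc hfS hfM hfL
  set N : ℝ := ((m + 1 : ℕ) : ℝ) with hN
  have hN1 : 1 ≤ N := by rw [hN]; exact_mod_cast Nat.succ_pos m
  set R := C ^ (m + 1) * N ^ (κ ^ 2 / (8 * Real.pi) * N) with hR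
  have hR0 : 0 ≤ R := by positivity
  have hpim : MeasurableSet (Set.univ.pi fun _ : Fin m => T) := MeasurableSet.univ_pi fun _ => hTm
  have hzero : ∀ (y : Fin m → ℂ) (j : Fin m), y j ∉ S → f j (y j) = 0 := fun y j hj =>
    image_eq_zero_of_notMem_tsupport fun h => hj (hfS j h)
  have hsupp : ∀ x, Function.support (onePointIntegrand Ω α f x) ⊆
      Set.univ.pi fun _ : Fin m => S := by
    intro x y hy j _
    by_contra hj
    exact hy (onePointIntegrand_eq_zero (hzero y j hj))
  have hsuppΩ : ∀ x, Function.support (onePointIntegrand Ω α f x) ⊆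
      Set.univ.pi fun _ : Fin m => Ω := fun x =>
    (hsupp x).trans (Set.pi_mono fun _ _ => hSΩ)
  -- A single domination argument, used with `q = M ^ m` for the values and with `q` proportional to
  -- `‖h‖` for the increments.
  have hlint : ∀ x ∈ K, ∀ q : ℝ, 0 ≤ q → ∀ F : (Fin m → ℂ) → ℂ,
      (∀ y, y ∉ (Set.univ.pi fun _ : Fin m => T) → F y = 0) →
      (∀ y ∈ Set.univ.pi fun _ : Fin m => T, ‖F y‖ ≤
        q * Real.exp (-coulombEnergy Ω α (Fin.cons x y : Fin (m + 1) → ℂ))) →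
      ∫⁻ y, ‖F y‖ₑ ≤ ENNReal.ofReal (q * R) := by
    intro x hx q hq F hF0 hF
    have h1 : ∀ y, ‖F y‖ₑ ≤ (Set.univ.pi fun _ : Fin m => T).indicator (fun y =>
        ENNReal.ofReal q * ENNReal.ofReal
          (Real.exp (-coulombEnergy Ω α (Fin.cons x y : Fin (m + 1) → ℂ)))) y := by
      intro y
      by_cases hy : y ∈ Set.univ.pi fun _ : Fin m => T
      · rw [Set.indicator_of_mem hy, ← ENNReal.ofReal_mul hq, ← ofReal_norm]
        exact ENNReal.ofReal_le_ofReal (hF y hy)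
      · simp [hF0 y hy]
    refine (lintegral_mono h1).trans ?_
    rw [lintegral_indicator hpim, lintegral_const_mul' _ _ ENNReal.ofReal_ne_top,
      ENNReal.ofReal_mul hq]
    exact mul_le_mul_right (hC m α hα x (hKT hx)) _
  have hprodM : ∀ y : Fin m → ℂ, (∀ j, y j ∈ Ω) → ∏ j, ‖f j (y j)‖ ≤ M ^ m := fun y hy =>
    (Finset.prod_le_prod (fun j _ => norm_nonneg _) fun j _ => hfM j _ (hy j)).trans
      (by simp)
  have hbound : ∀ x ∈ K, ∫⁻ y, ‖onePointIntegrand Ω α f x y‖ₑ ≤ ENNReal.ofReal (M ^ m * R) := by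
    intro x hx
    refine hlint x hx _ (by positivity) _ (fun y hy => ?_) fun y hy => ?_
    · by_contra h
      exact hy (Set.pi_mono (fun _ _ => hST) (hsupp x h))
    · rw [norm_onePointIntegrand]
      exact mul_le_mul_of_nonneg_right (hprodM y fun j => hTΩ (hy j (Set.mem_univ j)))
        (Real.exp_pos _).le
  have hint : ∀ x ∈ K, Integrable (onePointIntegrand Ω α f x) := by
    intro x hx
    have h1 : AEStronglyMeasurable (onePointIntegrand Ω α f x) volume := by
      have h2 := hG.aestronglyMeasurable_onePointIntegrand ho α hfc (hKΩ hx)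
      rw [← aestronglyMeasurable_indicator_iff
        (MeasurableSet.univ_pi fun _ => ho.measurableSet)] at h2
      rwa [Set.indicator_eq_self.2 (hsuppΩ x)] at h2
    exact ⟨h1, (hbound x hx).trans_lt ENNReal.ofReal_lt_top⟩
  -- The test functions already localise the integrand, so the domain can be the whole space, which
  -- is invariant under translation.
  have hfull : ∀ x, onePointIntegral Ω α f x = ∫ y, onePointIntegrand Ω α f x y := fun x =>
    setIntegral_eq_integral_of_forall_compl_eq_zero fun y hy => by
      by_contra h
      exact hy (hsuppΩ x h)
  have hval : ∀ x ∈ K, ‖onePointIntegral Ω α f x‖ ≤ M ^ m * R := by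
    intro x hx
    rw [hfull, ← ENNReal.ofReal_le_ofReal_iff (by positivity), ofReal_norm]
    exact (enorm_integral_le_lintegral_enorm _).trans (hbound x hx)
  have hlip : ∀ x ∈ K, ∀ x' ∈ K, ‖onePointIntegral Ω α f x' - onePointIntegral Ω α f x‖ ≤
      M ^ m * R * (N ^ 2 * Q) * ‖x' - x‖ := by
    intro x hx x' hx'
    set h := x' - x with hh
    by_cases hsmall : ‖h‖ < δ / N ^ 2
    · have hN2 : 1 ≤ N ^ 2 := one_le_pow₀ hN1
      have hhδ : ‖h‖ < δ := hsmall.trans_le (div_le_self hδ.le hN2)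
      have hhN : N ^ 2 * ‖h‖ ≤ 1 := by
        rw [lt_div_iff₀ (by positivity)] at hsmall
        linarith
      have hx'h : x' = x + h := by rw [hh]; ring
      -- Translating the other points along with `x` makes the two configurations differ by a common
      -- shift.
      have hshift : ∫ y, onePointIntegrand Ω α f x' y =
          ∫ y, onePointIntegrand Ω α f x' (y + fun _ => h) :=
        (integral_add_right_eq_self _ _).symm
      have hint' : Integrable fun y => onePointIntegrand Ω α f x' (y + fun _ => h) :=
        (hint x' hx').comp_add_right _
      rw [hfull, hfull, hshift, ← integral_sub hint' (hint x hx)]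
      rw [← ENNReal.ofReal_le_ofReal_iff (by positivity), ofReal_norm]
      refine (enorm_integral_le_lintegral_enorm _).trans ?_
      have hq : M ^ m * (N ^ 2 * Q) * ‖h‖ * R = M ^ m * R * (N ^ 2 * Q) * ‖h‖ := by ring
      rw [← hq]
      refine hlint x hx _ (by positivity) _ (fun y hy => ?_) fun y hy => ?_
      · simp only [Set.mem_pi, Set.mem_univ, true_implies, not_forall] at hy
        obtain ⟨j, hj⟩ := hy
        have h1 : f j (y j) = 0 := hzero y j fun hjS => hj (hST hjS)
        have h2 : f j ((y + fun _ : Fin m => h) j) = 0 := hzero _ j fun hjS => hj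
          (hmemT _ (Or.inr hjS) _ (by
            simp only [Pi.add_apply]
            rw [sub_add_cancel_left, norm_neg]
            exact hhδ.le))
        rw [onePointIntegrand_eq_zero h1, onePointIntegrand_eq_zero h2, sub_zero]
      · set X : Fin (m + 1) → ℂ := Fin.cons x y with hX
        have hXT : ∀ k, X k ∈ T := by
          intro k
          refine Fin.cases ?_ (fun j => ?_) k
          · simpa [hX] using hKT hx
          · simpa [hX] using hy j (Set.mem_univ j)
        have hyΩ : ∀ j, y j ∈ Ω := fun j => hTΩ (hy j (Set.mem_univ j))
        have hyΩ' : ∀ j, y j + h ∈ Ω := fun j => hTball _ (hy j (Set.mem_univ j)) (by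
          rw [Metric.mem_closedBall, dist_eq_norm, add_sub_cancel_left]; linarith)
        set t := coulombEnergy Ω α (fun k => X k + h) - coulombEnergy Ω α X with ht
        have ht1 : |t| ≤ A * (N ^ 2 * ‖h‖) :=
          hG.abs_coulombEnergy_add_sub_le hδ hL hL0 hα (fun k => hTball _ (hXT k)) hhδ
        have ht2 := abs_exp_neg_sub_one_le hhN (by positivity) hA0 ht1
        have hexp : Real.exp (-coulombEnergy Ω α (fun k => X k + h)) =
            Real.exp (-t) * Real.exp (-coulombEnergy Ω α X) := by
          rw [← Real.exp_add, ht]; congr 1; ring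
        rw [hx'h, onePointIntegrand, onePointIntegrand, cons_add_const, ← hX, hexp]
        -- Separates the change of the energy from the change of the test functions, with the
        -- unshifted Boltzmann factor left outside.
        have e1 : (∏ j, f j ((y + fun _ : Fin m => h) j)) *
              ((Real.exp (-t) * Real.exp (-coulombEnergy Ω α X) : ℝ) : ℂ) -
            (∏ j, f j (y j)) * (Real.exp (-coulombEnergy Ω α X) : ℂ) =
            ((∏ j, f j (y j + h)) * ((Real.exp (-t) - 1 : ℝ) : ℂ) +
              ((∏ j, f j (y j + h)) - ∏ j, f j (y j))) *
              (Real.exp (-coulombEnergy Ω α X) : ℂ) := by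
          simp only [Pi.add_apply]
          push_cast
          ring
        rw [e1, norm_mul, Complex.norm_real, Real.norm_eq_abs, abs_of_pos (Real.exp_pos _)]
        refine mul_le_mul_of_nonneg_right ?_ (Real.exp_pos _).le
        have n1 : ‖∏ j, f j (y j + h)‖ ≤ M ^ m := by
          rw [norm_prod]
          exact hprodM (fun j => y j + h) hyΩ'
        have n2 : ‖(∏ j, f j (y j + h)) - ∏ j, f j (y j)‖ ≤ m * (M ^ m * ‖h‖) := by
          have := norm_prod_sub_prod_le (Finset.univ : Finset (Fin m))
            (a := fun j => f j (y j + h)) (b := fun j => f j (y j)) (M := M) (e := ‖h‖)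
            (fun j _ => hfM j _ (hyΩ' j)) (fun j _ => hfM j _ (hyΩ j))
            (fun j _ => by simpa using hfL j _ (hyΩ' j) _ (hyΩ j)) hM
          simpa using this
        have hmN : (m : ℝ) ≤ N ^ 2 := by
          have h1 : (m : ℝ) ≤ N := by rw [hN]; push_cast; linarith
          nlinarith
        have hMm : 0 ≤ M ^ m := by positivity
        calc _ ≤ ‖∏ j, f j (y j + h)‖ * |Real.exp (-t) - 1| +
              ‖(∏ j, f j (y j + h)) - ∏ j, f j (y j)‖ := by
              refine (norm_add_le _ _).trans ?_
              rw [norm_mul, Complex.norm_real, Real.norm_eq_abs]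
          _ ≤ M ^ m * (A * Real.exp A * (N ^ 2 * ‖h‖)) + N ^ 2 * (M ^ m * ‖h‖) := by
              refine add_le_add (mul_le_mul n1 ht2 (abs_nonneg _) hMm) (n2.trans ?_)
              exact mul_le_mul_of_nonneg_right hmN (by positivity)
          _ = M ^ m * (N ^ 2 * (1 + A * Real.exp A)) * ‖h‖ := by ring
          _ ≤ M ^ m * (N ^ 2 * Q) * ‖h‖ := by
              gcongr
              have : 0 ≤ 2 / δ := by positivity
              linarith
    · have h1 : 2 ≤ N ^ 2 * Q * ‖h‖ := by
        rw [not_lt, div_le_iff₀ (by positivity)] at hsmall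
        have h2 : 2 / δ ≤ Q := by
          have : 0 ≤ A * Real.exp A := by positivity
          linarith
        calc 2 = 2 / δ * δ := by field_simp
          _ ≤ Q * (‖h‖ * N ^ 2) := mul_le_mul h2 hsmall hδ.le (by linarith)
          _ = _ := by ring
      calc _ ≤ ‖onePointIntegral Ω α f x'‖ + ‖onePointIntegral Ω α f x‖ := norm_sub_le _ _
        _ ≤ M ^ m * R * 2 := by linarith [hval x hx, hval x' hx']
        _ ≤ M ^ m * R * (N ^ 2 * Q * ‖h‖) :=
            mul_le_mul_of_nonneg_left h1 (by positivity)
        _ = _ := by ring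
  refine ⟨fun x hx => (hint x hx).integrableOn, ?_⟩
  rintro P rfl
  have hfin : M ^ m * R * (N ^ 2 * Q) ≤ (C * ((M + 1) * (4 * Q))) ^ (m + 1) *
      N ^ (κ ^ 2 / (8 * Real.pi) * N) := by
    have h1 : M ^ m ≤ (M + 1) ^ (m + 1) :=
      (pow_le_pow_left₀ hM (by linarith) m).trans
        (pow_le_pow_right₀ (by linarith) (Nat.le_succ m))
    have h2 : N ^ 2 ≤ 4 ^ (m + 1) := by
      have h3 : m + 1 ≤ 2 ^ (m + 1) := Nat.lt_two_pow_self.le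
      have h4 : N ≤ 2 ^ (m + 1) := by rw [hN]; exact_mod_cast h3
      calc N ^ 2 ≤ (2 ^ (m + 1)) ^ 2 := by gcongr
        _ = 4 ^ (m + 1) := by rw [← pow_mul, mul_comm, pow_mul]; norm_num
    have h3 : Q ≤ Q ^ (m + 1) := le_self_pow₀ hQ1 (by omega)
    calc M ^ m * R * (N ^ 2 * Q) ≤ (M + 1) ^ (m + 1) * R * (4 ^ (m + 1) * Q ^ (m + 1)) := by
          gcongr
      _ = _ := by rw [hR, mul_pow, mul_pow, mul_pow]; ring
  refine ⟨fun x hx => (hval x hx).trans (le_trans ?_ hfin), fun x hx x' hx' =>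
    (hlip x hx x' hx').trans (mul_le_mul_of_nonneg_right hfin (norm_nonneg _))⟩
  exact le_mul_of_one_le_right (by positivity)
    (one_le_mul_of_one_le_of_one_le (one_le_pow₀ hN1) hQ1)

end IsLogKernel

/-! ### The Lipschitz norm and the final choice of the constant. -/

theorem enorm_le_lipNorm {A : Set ℂ} {f : ℂ → ℂ} {x : ℂ} (hx : x ∈ A) :
    ‖f x‖ₑ ≤ lipNorm A f :=
  (le_iSup₂_of_le (f := fun x (_ : x ∈ A) => ‖f x‖ₑ) x hx le_rfl).trans le_self_add

theorem enorm_sub_le_lipNorm {A : Set ℂ} {f : ℂ → ℂ} {x y : ℂ} (hx : x ∈ A) (hy : y ∈ A) :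
    ‖f x - f y‖ₑ ≤ lipNorm A f * ‖x - y‖ₑ := by
  rcases eq_or_ne x y with rfl | hxy
  · simp
  have h1 : ‖f x - f y‖ₑ / ‖x - y‖ₑ ≤ lipNorm A f :=
    (le_iSup₂_of_le (f := fun x (_ : x ∈ A) => ⨆ y ∈ A, ⨆ _ : x ≠ y, ‖f x - f y‖ₑ / ‖x - y‖ₑ)
      x hx (le_iSup₂_of_le (f := fun y (_ : y ∈ A) => ⨆ _ : x ≠ y, ‖f x - f y‖ₑ / ‖x - y‖ₑ)
        y hy (le_iSup_of_le hxy le_rfl))).trans le_add_self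
  have h2 : ‖x - y‖ₑ ≠ 0 := by simpa [sub_eq_zero] using hxy
  exact (ENNReal.div_le_iff h2 enorm_ne_top).1 h1

theorem lipNorm_le {A : Set ℂ} {f : ℂ → ℂ} {p q : ENNReal} (hp : ∀ x ∈ A, ‖f x‖ₑ ≤ p)
    (hq : ∀ x ∈ A, ∀ y ∈ A, ‖f x - f y‖ₑ ≤ q * ‖x - y‖ₑ) : lipNorm A f ≤ p + q := by
  refine add_le_add (iSup₂_le hp) (iSup₂_le fun x hx => iSup₂_le fun y hy => iSup_le fun hxy => ?_)
  have h2 : ‖x - y‖ₑ ≠ 0 := by simpa [sub_eq_zero] using hxy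
  exact (ENNReal.div_le_iff h2 enorm_ne_top).2 (hq x hx y hy)

theorem lipNorm_lt_top {A : Set ℂ} {f : ℂ → ℂ} (hf : ContDiff ℝ ∞ f) (hc : HasCompactSupport f) :
    lipNorm A f < ⊤ := by
  obtain ⟨B, hB⟩ := hc.exists_bound_of_continuous hf.continuous
  obtain ⟨L, hL⟩ := ContDiff.lipschitzWith_of_hasCompactSupport hc hf (by simp)
  refine (lipNorm_le (p := ENNReal.ofReal B) (q := L) (fun x _ => ?_) fun x _ y _ => ?_).trans_lt
    (ENNReal.add_lt_top.2 ⟨ENNReal.ofReal_lt_top, ENNReal.coe_lt_top⟩)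
  · rw [← ofReal_norm]
    exact ENNReal.ofReal_le_ofReal (hB x)
  · simpa [edist_eq_enorm_sub] using hL x y

/-- Here `n = m + 1 ≥ 2`, and the constant is a function of `‖α‖`, of the union of the supports
of the `f_i` and of the maximum of their Lipschitz norms, chosen for given `Ω` and `K`. -/
theorem proposition3p6 (Ω : Set ℂ) (hΩ : IsSmoothBoundedOpen Ω)
    (K : Set ℂ) (hK : IsCompact K) (hKΩ : K ⊆ Ω) :
    ∃ C : ℝ → Set ℂ → ENNReal → ℝ, (∀ a S M, 0 < C a S M) ∧
      ∀ (m : ℕ), 1 ≤ m → ∀ (α : Fin (m + 1) → ℝ) (f : Fin m → ℂ → ℂ),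
        (∀ i, |α i| < Real.sqrt (4 * Real.pi)) →
        (∀ j, ContDiff ℝ ∞ (f j) ∧ HasCompactSupport (f j) ∧ tsupport (f j) ⊆ Ω) →
        (∀ x₁ ∈ Ω, IntegrableOn (onePointIntegrand Ω α f x₁)
          (Set.univ.pi fun _ : Fin m => Ω)) ∧
        (∃ L : NNReal, LipschitzOnWith L (onePointIntegral Ω α f) K) ∧
        lipNorm K (onePointIntegral Ω α f) ≤ ENNReal.ofReal
          (C (chargeNorm α) (⋃ j, tsupport (f j)) (⨆ j, lipNorm Ω (f j)) ^ (m + 1) *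
            ((m + 1 : ℕ) : ℝ) ^ (chargeNorm α ^ 2 / (8 * Real.pi) * ((m + 1 : ℕ) : ℝ))) := by
  have ho := hΩ.isOpen
  have hb := hΩ.isBounded
  obtain ⟨c, g, B, hG⟩ := exists_isLogKernel ho hb
  -- Fixing the three parameters before `m`, `α` and `f` lets the constant be chosen as a function
  -- of them.
  have key : ∀ (κ : ℝ) (S : Set ℂ) (M : ENNReal), ∃ C : ℝ, 0 < C ∧
      ∀ (m : ℕ) (α : Fin (m + 1) → ℝ) (f : Fin m → ℂ → ℂ),
        (∀ i, |α i| < Real.sqrt (4 * Real.pi)) →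
        (∀ j, ContDiff ℝ ∞ (f j) ∧ HasCompactSupport (f j) ∧ tsupport (f j) ⊆ Ω) →
        chargeNorm α = κ → ⋃ j, tsupport (f j) = S → ⨆ j, lipNorm Ω (f j) = M →
        (∀ x₁ ∈ Ω, IntegrableOn (onePointIntegrand Ω α f x₁)
          (Set.univ.pi fun _ : Fin m => Ω)) ∧
        (∃ L : NNReal, LipschitzOnWith L (onePointIntegral Ω α f) K) ∧
        lipNorm K (onePointIntegral Ω α f) ≤ ENNReal.ofReal (C ^ (m + 1) *
            ((m + 1 : ℕ) : ℝ) ^ (κ ^ 2 / (8 * Real.pi) * ((m + 1 : ℕ) : ℝ))) := by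
    intro κ S M
    by_cases hgood : 0 ≤ κ ∧ κ < Real.sqrt (4 * Real.pi) ∧ IsCompact S ∧ S ⊆ Ω ∧ M ≠ ⊤
    · obtain ⟨hκ, hκ1, hS, hSΩ, hM⟩ := hgood
      obtain ⟨C, hC1, hC⟩ := hG.exists_onePointIntegral_bounds ho hb hκ hκ1 hK hKΩ hS hSΩ
        (ENNReal.toReal_nonneg (a := M))
      refine ⟨2 * C, by linarith, ?_⟩
      intro m α f _ hf hακ hfS hfM
      have hα : ∀ k, |α k| ≤ κ := fun k =>
        hακ ▸ le_ciSup (f := fun k => |α k|) (Set.finite_range _).bddAbove k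
      have hfc : ∀ j, Continuous (f j) := fun j => (hf j).1.continuous
      have hfS' : ∀ j, tsupport (f j) ⊆ S := fun j =>
        hfS ▸ Set.subset_iUnion (fun j => tsupport (f j)) j
      have hfM' : ∀ j, lipNorm Ω (f j) ≤ M := fun j =>
        hfM ▸ le_iSup (fun j => lipNorm Ω (f j)) j
      have hsup : ∀ j, ∀ z ∈ Ω, ‖f j z‖ ≤ M.toReal := fun j z hz => by
        rw [← toReal_enorm]
        exact ENNReal.toReal_mono hM ((enorm_le_lipNorm hz).trans (hfM' j))
      have hlip : ∀ j, ∀ z ∈ Ω, ∀ w ∈ Ω, ‖f j z - f j w‖ ≤ M.toReal * ‖z - w‖ :=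
        fun j z hz w hw => by
          rw [← toReal_enorm, ← toReal_enorm, ← ENNReal.toReal_mul]
          exact ENNReal.toReal_mono (ENNReal.mul_ne_top hM enorm_ne_top)
            ((enorm_sub_le_lipNorm hz hw).trans (mul_le_mul_left (hfM' j) _))
      obtain ⟨-, hbd⟩ := hC m α f hα hfc hfS' hsup hlip
      obtain ⟨hval, hinc⟩ := hbd _ rfl
      set P := C ^ (m + 1) * ((m + 1 : ℕ) : ℝ) ^ (κ ^ 2 / (8 * Real.pi) * ((m + 1 : ℕ) : ℝ))
        with hP
      have hP0 : 0 ≤ P := by positivity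
      refine ⟨fun x₁ hx₁ => ?_, ⟨P.toNNReal, ?_⟩, ?_⟩
      -- Integrability at an arbitrary point of `Ω` needs no uniform constant, so the compact set
      -- can be that point alone.
      · obtain ⟨C', -, hC'⟩ := hG.exists_onePointIntegral_bounds ho hb hκ hκ1
          (isCompact_singleton (x := x₁)) (Set.singleton_subset_iff.2 hx₁) hS hSΩ
          (ENNReal.toReal_nonneg (a := M))
        exact (hC' m α f hα hfc hfS' hsup hlip).1 x₁ rfl
      · refine LipschitzOnWith.of_dist_le_mul fun x hx y hy => ?_
        rw [dist_eq_norm, dist_eq_norm, Real.coe_toNNReal _ hP0]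
        exact hinc y hy x hx
      · refine (lipNorm_le (p := ENNReal.ofReal P) (q := ENNReal.ofReal P) (fun x hx => ?_)
          fun x hx y hy => ?_).trans ?_
        · rw [← ofReal_norm]
          exact ENNReal.ofReal_le_ofReal (hval x hx)
        · rw [← ofReal_norm, ← ofReal_norm, ← ENNReal.ofReal_mul hP0]
          exact ENNReal.ofReal_le_ofReal (hinc y hy x hx)
        · rw [← ENNReal.ofReal_add hP0 hP0]
          refine ENNReal.ofReal_le_ofReal ?_
          -- The Lipschitz norm is a sum of two suprema, each at most `P`; the constant `2 * C`
          -- absorbs the factor 2.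
          rw [mul_pow, mul_assoc, ← hP, ← two_mul]
          exact mul_le_mul_of_nonneg_right (le_self_pow₀ (by norm_num) (by omega)) hP0
    -- Such parameters never occur: the maximum of the charges is attained, a finite union of
    -- compact supports in `Ω` is compact in `Ω`, and a finite supremum of finite norms is finite.
    · refine ⟨1, one_pos, ?_⟩
      intro m α f hα hf hακ hfS hfM
      refine (hgood ⟨?_, ?_, ?_, ?_, ?_⟩).elim
      · exact hακ ▸ Real.iSup_nonneg fun k => abs_nonneg _
      · obtain ⟨k, hk⟩ := exists_eq_ciSup_of_finite (f := fun k => |α k|)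
        rw [← hακ, chargeNorm, ← hk]
        exact hα k
      · exact hfS ▸ isCompact_iUnion fun j => (hf j).2.1
      · exact hfS ▸ Set.iUnion_subset fun j => (hf j).2.2
      · rw [← hfM, ← lt_top_iff_ne_top, ← Finset.sup_univ_eq_iSup,
          Finset.sup_lt_iff ENNReal.zero_lt_top]
        exact fun j _ => lipNorm_lt_top (hf j).1 (hf j).2.1
  choose C hC0 hC using key
  exact ⟨C, hC0, fun m _ α f hα hf => hC _ _ _ m α f hα hf rfl rfl rfl⟩
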